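/- Let $G$ be a finite group, $\pi\colon G\to U(V)$ a unitary representation on a nonzero finite-dimensional complex Hilbert space $V$, $X$ a transitive left $G$-set and $f\colon G\to X$ a map of left $G$-sets (that is, $f(gh)=g\,f(h)$), and let $H\le G$ be the stabilizer of a point $x_0\in X$ (for example $X=G/H$ and $f(g)=gH$). In the coset identification problem $(G,V,f)$ the task is to determine $f(a)$ for a uniformly random hidden $a\in G$, given oracle access to $\pi(a)$. A $t$-query quantum algorithm consists of a workspace dimension $N$, a unit vector $\psi\in V\otimes\mathbb C^N$, unitary operators $U_1,\dots,U_t$ on $V\otimes\mathbb C^N$ and a POVM $\{E_x\}_{x\in X}$ on $V\otimes\mathbb C^N$. It produces the state $\psi_a=U_t(\pi(a)\otimes I)U_{t-1}(\pi(a)\otimes I)\cdots U_1(\pi(a)\otimes I)\psi$, and its success probability is $\frac1{|G|}\sum_{a\in G}\langle\psi_a|E_{f(a)}|\psi_a\rangle$. The exact (respectively bounded-error) query complexity is the least $t\ge 0$ for which some $t$-query algorithm has success probability $1$ (respectively at least $2/3$), and $\infty$ if there is no such $t$. For a representation $Y$ of $H$ let $Y^{\uparrow}$ be the representation of $G$ induced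 from $Y$; for representations $A,B$ of $G$ let $A_B$ be the largest subrepresentation of $A$ all of whose irreducible constituents also appear in $B$; and let $\mathrm{Irr}(H)$ be the set of (isomorphism classes of) irreducible complex representations of $H$. Then: 1. For every integer $t\ge 0$, the maximum of the success probabilities of all $t$-query algorithms exists and equals $$\max_{Y\in\mathrm{Irr}(H)}\frac{\dim\,(Y^{\uparrow})_{V^{\otimes t}}}{\dim Y^{\uparrow}}.$$ 2. The exact query complexity is the least $t$ for which there is some $Y\in\mathrm{Irr}(H)$ such that every irreducible representation of $G$ appearing in $Y^{\uparrow}$ also appears in $V^{\otimes t}$ ($\infty$ if there is no such $t$). 3. The bounded-error query complexity is the least $t$ for which $$\max_{Y\in\mathrm{Irr}(H)}\frac{\dim\,(Y^{\uparrow})_{V^{\otimes t}}}{\dim Y^{\uparrow}}\ge\frac23$$ ($\infty$ if there is no such $t$). -/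

import Mathlib

open scoped TensorProduct

namespace QuantumQuery

noncomputable section

/-! ### Coset identification and adaptive query algorithms -/

/-- The function to be learned in a coset identification problem: a surjective map of left
`G`-sets from `G` to `X` (so `X` is transitive and the fibres of `f` are the left cosets of the
stabilizer of `f 1`). -/
structure IsCosetIdentification {G X : Type*} [Group G] [MulAction G X] (f : G → X) : Prop where
  surjective : Function.Surjective f
  equivariant : ∀ g h : G, f (g * h) = g • f h

/-- The register `V ⊗ ℂ^N`: the query space together with an `N`-dimensional workspace. -/
abbrev Register (V : Type*) [NormedAddCommGroup V] [InnerProductSpace ℂ V] (N : ℕ) : Type _ :=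
  V ⊗[ℂ] EuclideanSpace ℂ (Fin N)

/-- A `t`-query (adaptive) quantum algorithm with query space `V` and outcomes in `X`:
a workspace dimension, a unit input vector, `t` unitaries and a POVM indexed by `X`. -/
structure QueryAlgorithm (V : Type*) [NormedAddCommGroup V] [InnerProductSpace ℂ V]
    (X : Type*) [Fintype X] (t : ℕ) where
  /-- dimension of the workspace -/
  N : ℕ
  /-- input state -/
  input : Register V N
  norm_input : ‖input‖ = 1
  /-- the unitary applied after the query with index `i` -/
  U : Fin t → (Register V N ≃ₗᵢ[ℂ] Register V N)
  /-- the measurement operators -/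
  E : X → (Register V N →ₗ[ℂ] Register V N)
  E_pos : ∀ x, (E x).IsPositive
  E_sum : ∑ x, E x = LinearMap.id

section Algorithm

variable {G V X : Type*} [Group G] [NormedAddCommGroup V] [InnerProductSpace ℂ V] [Fintype X]

/-- The state `U_t (π(a) ⊗ I) ⋯ U_1 (π(a) ⊗ I) ψ` before the measurement, when the hidden group
element is `a`. -/
def QueryAlgorithm.output {t : ℕ} (A : QueryAlgorithm V X t) (π : G →* (V ≃ₗᵢ[ℂ] V)) (a : G) :
    Register V A.N :=
  Fin.foldl t
    (fun φ i => A.U i ((π a).rTensor (EuclideanSpace ℂ (Fin A.N)) φ)) A.input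

/-- The probability of the outcome `x` when the hidden group element is `a`. -/
def QueryAlgorithm.outcomeProb {t : ℕ} (A : QueryAlgorithm V X t) (π : G →* (V ≃ₗᵢ[ℂ] V))
    (a : G) (x : X) : ℝ :=
  (inner ℂ (A.output π a) (A.E x (A.output π a))).re

/-- The probability that the algorithm outputs `f a`, for `a` uniformly distributed in `G`. -/
def QueryAlgorithm.successProb {t : ℕ} (A : QueryAlgorithm V X t) [Fintype G]
    (π : G →* (V ≃ₗᵢ[ℂ] V)) (f : G → X) : ℝ :=
  (1 / (Fintype.card G : ℝ)) * ∑ a : G, A.outcomeProb π a (f a)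

/-- The set of success probabilities of all `t`-query algorithms. -/
def successProbs [Fintype G] (π : G →* (V ≃ₗᵢ[ℂ] V)) (f : G → X) (t : ℕ) : Set ℝ :=
  Set.range fun A : QueryAlgorithm V X t => A.successProb π f

/-- The least element of a set of natural numbers, `∞` if the set is empty. -/
def leastOrTop (S : Set ℕ) : ℕ∞ := ⨅ t ∈ S, (t : ℕ∞)

/-- The exact (zero error) query complexity: the least number of queries of an algorithm that
succeeds with probability `1`. -/
def exactQueryComplexity [Fintype G] (π : G →* (V ≃ₗᵢ[ℂ] V)) (f : G → X) : ℕ∞ :=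
  leastOrTop {t | ∃ A : QueryAlgorithm V X t, A.successProb π f = 1}

/-- The bounded error query complexity: the least number of queries of an algorithm that
succeeds with probability at least `2 / 3`. -/
def boundedErrorQueryComplexity [Fintype G] (π : G →* (V ≃ₗᵢ[ℂ] V)) (f : G → X) : ℕ∞ :=
  leastOrTop {t | ∃ A : QueryAlgorithm V X t, 2 / 3 ≤ A.successProb π f}

end Algorithm

/-! ### Representations -/

section Rep

variable {G : Type*} [Group G] {A B : Type*} [AddCommGroup A] [Module ℂ A]
  [AddCommGroup B] [Module ℂ B]

/-- The representation `ρ` appears in the representation `τ` (as a subrepresentation). -/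
def AppearsIn (ρ : Representation ℂ G A) (τ : Representation ℂ G B) : Prop :=
  ∃ j : Representation.IntertwiningMap ρ τ, Function.Injective j

/-- `I(ρ) ⊆ I(τ)`: every irreducible representation appearing in `ρ` also appears in `τ`. -/
def IrrepsSubset (ρ : Representation ℂ G A) (τ : Representation ℂ G B) : Prop :=
  ∀ S : Subrepresentation ρ, S.toRepresentation.IsIrreducible → AppearsIn S.toRepresentation τ

/-- The part `A_B` of `A` shared with `B`: the largest subrepresentation of `A` all of whose
irreducible constituents appear in `B`, as the sum of all subrepresentations with this property. -/
def sharedPart (ρ : Representation ℂ G A) (τ : Representation ℂ G B) : Submodule ℂ A :=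
  ⨆ S : {S : Subrepresentation ρ // IrrepsSubset S.toRepresentation τ}, S.1.toSubmodule

variable {V : Type*} [NormedAddCommGroup V] [InnerProductSpace ℂ V]

/-- The representation of `G` on `V^{⊗t}` in which `g` acts by `π(g)^{⊗t}`. -/
def tensorPowerRep (π : G →* (V ≃ₗᵢ[ℂ] V)) (t : ℕ) : Representation ℂ G (⨂[ℂ]^t V) where
  toFun g := PiTensorProduct.map fun _ : Fin t => ((π g).toLinearEquiv : V →ₗ[ℂ] V)
  map_one' := by
    rw [map_one]
    exact PiTensorProduct.map_one
  map_mul' g h := by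
    rw [map_mul]
    exact PiTensorProduct.map_mul (fun _ : Fin t => ((π g).toLinearEquiv : V →ₗ[ℂ] V))
      (fun _ => ((π h).toLinearEquiv : V →ₗ[ℂ] V))

/-- The fraction `dim (Y↑)_{V^{⊗t}} / dim Y↑` for a representation `Y` of the subgroup `H`, where
`Y↑` is the induced representation of `G`. -/
def sharedFraction (π : G →* (V ≃ₗᵢ[ℂ] V)) (t : ℕ) {H : Subgroup G}
    (Y : Representation ℂ H A) : ℝ :=
  (Module.finrank ℂ (sharedPart (Representation.ind H.subtype Y) (tensorPowerRep π t)) : ℝ) /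
    (Module.finrank ℂ (Representation.IndV H.subtype Y) : ℝ)

/-- The set of the fractions `dim (Y↑)_{V^{⊗t}} / dim Y↑`, where `Y` runs over the irreducible
representations of `H` (up to isomorphism each of them lives on some `ℂ^n : Type`). -/
def sharedFractions (π : G →* (V ≃ₗᵢ[ℂ] V)) (H : Subgroup G) (t : ℕ) : Set ℝ :=
  {r | ∃ (W : Type) (_ : AddCommGroup W) (_ : Module ℂ W) (Y : Representation ℂ H W),
    Y.IsIrreducible ∧ r = sharedFraction π t Y}

/-- `max_Y dim (Y↑)_{V^{⊗t}} / dim Y↑` over the irreducible representations `Y` of `H`. -/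
def maxSharedFraction (π : G →* (V ≃ₗᵢ[ℂ] V)) (H : Subgroup G) (t : ℕ) : ℝ :=
  sSup (sharedFractions π H t)

/-- Some irreducible representation `Y` of `H` has the property that every irreducible
representation of `G` appearing in `Y↑` appears in `V^{⊗t}`. -/
def ExistsCoveredIrrep (π : G →* (V ≃ₗᵢ[ℂ] V)) (H : Subgroup G) (t : ℕ) : Prop :=
  ∃ (W : Type) (_ : AddCommGroup W) (_ : Module ℂ W) (Y : Representation ℂ H W),
    Y.IsIrreducible ∧ IrrepsSubset (Representation.ind H.subtype Y) (tensorPowerRep π t)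

end Rep

end

end QuantumQuery

open QuantumQuery

namespace QuantumQuery

/-! ### Translation-invariant spaces of functions and their central idempotents -/

section Idempotent

/-! Let M ⊆ L²(G) be the span of the matrix coefficients of V^{⊗t}. Two facts turn the problem into
harmonic analysis on G. As a function of a, every linear functional of the final state ψ_a of a
t-query algorithm lies in M, whatever the intermediate unitaries are (`foldl_mem_prodCoeffSpan`).
Conversely, for φ in M the right translates R(a)φ have the Gram matrix of the final states of some
t-query circuit (`exists_isReachable_gram`), so a suitable POVM on that circuit reproduces the
standard-basis measurement of R(a)φ. The fibres of f are two-sided translates of H and M is stable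
under translations on both sides, so the optimal success probability is the largest fraction of its
L²-mass that a function in M can have on H.

The orthogonal projection P_M is right translation by a central idempotent e of the group algebra,
and in every finite-dimensional representation e acts as a projection onto the part shared with
V^{⊗t} (`sharedPart_eq_range`). Compressed to functions on H, P_M becomes the action of the class
function e|_H, which is a scalar c_Y on each irreducible Y of H. Writing P_H for restriction to H,
the largest fraction is ‖P_H P_M‖² = ‖P_H P_M P_H‖ = max c_Y (`sum_subgroup_le`,
`exists_sum_subgroup_eq`). Finally e has trace [G:H] c_Y dim Y on Y↑, whose dimension is [G:H] dim
Y, so c_Y is exactly the shared fraction (`sharedFraction_eq`). The two query complexities follow by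
comparing this maximum with 1 and with 2/3. -/

theorem reproducing_vector_unique {G : Type*} [Fintype G] {M : Submodule ℂ (G → ℂ)} {ε ε' : G → ℂ}
    (hε : ε ∈ M) (hε' : ε' ∈ M)
    (h : ∀ φ ∈ M, ∑ k, starRingEnd ℂ (ε k) * φ k = ∑ k, starRingEnd ℂ (ε' k) * φ k) : ε = ε' := by
  have h1 := h (ε - ε') (M.sub_mem hε hε')
  rw [← sub_eq_zero, ← Finset.sum_sub_distrib] at h1
  have h2 : ∑ k, ‖ε k - ε' k‖ ^ 2 = 0 := by
    apply Complex.ofReal_injective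
    rw [Complex.ofReal_zero, ← h1, Complex.ofReal_sum]
    refine Finset.sum_congr rfl fun k _ => ?_
    rw [Complex.ofReal_pow, ← Complex.conj_mul', map_sub, Pi.sub_apply, sub_mul]
  funext k
  have h3 := (Finset.sum_eq_zero_iff_of_nonneg (fun k _ => by positivity)).1 h2 k
    (Finset.mem_univ k)
  simpa [sub_eq_zero] using h3

variable {G : Type*} [Group G]

/-- A space of functions on `G` that is stable under left and right translations. -/
structure IsBiInvariant (M : Submodule ℂ (G → ℂ)) : Prop where
  left : ∀ φ ∈ M, ∀ g : G, (fun k => φ (g * k)) ∈ M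
  right : ∀ φ ∈ M, ∀ g : G, (fun k => φ (k * g)) ∈ M

/-- `e` is (the coefficient function of) the central idempotent of the group algebra whose action
by right translation is the orthogonal projection onto `M`. -/
structure IsProjectionKernel [Fintype G] (M : Submodule ℂ (G → ℂ)) (e : G → ℂ) : Prop where
  conj_inv : ∀ g h : G, e (h * g * h⁻¹) = e g
  map_inv : ∀ g : G, e g⁻¹ = starRingEnd ℂ (e g)
  reproducing : ∀ φ ∈ M, ∀ g : G, ∑ k, e k * φ (g * k) = φ g
  inv_mem : (fun g => e g⁻¹) ∈ M

/-- Riesz representation of evaluation at 1, for M as a subspace of L²(G). -/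
theorem exists_reproducing_vector [Fintype G] (M : Submodule ℂ (G → ℂ)) :
    ∃ ε ∈ M, ∀ φ ∈ M, ∑ k, starRingEnd ℂ (ε k) * φ k = φ 1 := by
  let M' : Submodule ℂ (EuclideanSpace ℂ G) := M.comap (WithLp.linearEquiv 2 ℂ (G → ℂ)).toLinearMap
  let ev : M' →ₗ[ℂ] ℂ := (LinearMap.proj 1 ∘ₗ (WithLp.linearEquiv 2 ℂ (G → ℂ)).toLinearMap) ∘ₗ
    M'.subtype
  let ε := (InnerProductSpace.toDual ℂ M').symm (LinearMap.toContinuousLinearMap ev)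
  refine ⟨WithLp.ofLp (ε : EuclideanSpace ℂ G), ε.2, fun φ hφ => ?_⟩
  have h := InnerProductSpace.toDual_symm_apply (𝕜 := ℂ) (E := M')
    (x := ⟨WithLp.toLp 2 φ, hφ⟩) (y := LinearMap.toContinuousLinearMap ev)
  have h2 : inner ℂ ε (⟨WithLp.toLp 2 φ, hφ⟩ : M') = φ 1 := h
  rw [Submodule.coe_inner, PiLp.inner_apply] at h2
  simpa [mul_comm] using h2

theorem IsBiInvariant.exists_isProjectionKernel [Fintype G] {M : Submodule ℂ (G → ℂ)}
    (hM : IsBiInvariant M) : ∃ e : G → ℂ, IsProjectionKernel M e := by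
  obtain ⟨ε, hε, hrep⟩ := exists_reproducing_vector M
  have hrep' : ∀ φ ∈ M, ∀ g : G, ∑ k, starRingEnd ℂ (ε k) * φ (g * k) = φ g := fun φ hφ g => by
    simpa using hrep _ (hM.left φ hφ g)
  -- The reproducing property applied to ε itself makes ε(g⁻¹k) a Hermitian kernel.
  have hinv : ∀ g, ε g⁻¹ = starRingEnd ℂ (ε g) := fun g => by
    rw [← hrep' ε hε g, ← hrep' ε hε g⁻¹, map_sum]
    rw [← Equiv.sum_comp (Equiv.mulLeft g)]
    refine Finset.sum_congr rfl fun k _ => ?_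
    simp [mul_comm]
  have hconj : ∀ g h, ε (h * g * h⁻¹) = ε g := fun g h => by
    have hmem : ∀ φ ∈ M, ∀ h : G, (fun g => φ (h * g * h⁻¹)) ∈ M := fun φ hφ h => by
      have := hM.right _ (hM.left φ hφ h) h⁻¹
      simpa [mul_assoc] using this
    -- Conjugation fixes 1, so the conjugate of ε represents the same functional and uniqueness
    -- applies.
    have : (fun g => ε (h * g * h⁻¹)) = ε := by
      refine reproducing_vector_unique (hmem ε hε h) hε fun φ hφ => ?_
      rw [hrep φ hφ]
      have h1 := hrep _ (hmem φ hφ h⁻¹)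
      rw [← Equiv.sum_comp (MulAut.conj h).toEquiv] at h1
      simpa [mul_assoc] using h1
    exact congrFun this g
  -- The conjugate is taken because `reproducing` is a bilinear sum. Then e(g⁻¹) = ε(g), which is
  -- why it is the inverted function that lies in M.
  refine ⟨fun g => starRingEnd ℂ (ε g), fun g h => by simp only [hconj], fun g => by simp [hinv],
    hrep', ?_⟩
  simpa [hinv] using hε

end Idempotent

/-! ### Action of a central idempotent on a representation -/

section KernelAction

variable {G : Type*} [Group G] {A B : Type*} [AddCommGroup A] [Module ℂ A]
  [AddCommGroup B] [Module ℂ B]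

/-- The action of the group algebra element `∑ g, e g • g` in a representation. -/
noncomputable def kernelAction [Fintype G] (e : G → ℂ) (ρ : Representation ℂ G A) : A →ₗ[ℂ] A :=
  ∑ g, e g • ρ g

theorem kernelAction_apply [Fintype G] (e : G → ℂ) (ρ : Representation ℂ G A) (v : A) :
    kernelAction e ρ v = ∑ g, e g • ρ g v := by
  simp [kernelAction, LinearMap.sum_apply]

/-- The space of matrix coefficients of a representation. -/
def coeffSpace (ρ : Representation ℂ G A) : Submodule ℂ (G → ℂ) :=
  Submodule.span ℂ (Set.range fun x : Module.Dual ℂ A × A => fun g => x.1 (ρ g x.2))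

theorem coeff_mem_coeffSpace (ρ : Representation ℂ G A) (l : Module.Dual ℂ A) (v : A) :
    (fun g => l (ρ g v)) ∈ coeffSpace ρ :=
  Submodule.subset_span ⟨(l, v), rfl⟩

theorem isBiInvariant_coeffSpace (ρ : Representation ℂ G A) : IsBiInvariant (coeffSpace ρ) where
  left φ hφ g := by
    induction hφ using Submodule.span_induction with
    | mem φ h =>
      obtain ⟨x, rfl⟩ := h
      simpa using coeff_mem_coeffSpace ρ (x.1 ∘ₗ ρ g) x.2
    | zero => exact Submodule.zero_mem _
    | add φ ψ _ _ h1 h2 => exact Submodule.add_mem _ h1 h2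
    | smul c φ _ h => exact Submodule.smul_mem _ c h
  right φ hφ g := by
    induction hφ using Submodule.span_induction with
    | mem φ h =>
      obtain ⟨x, rfl⟩ := h
      simpa using coeff_mem_coeffSpace ρ x.1 (ρ g x.2)
    | zero => exact Submodule.zero_mem _
    | add φ ψ _ _ h1 h2 => exact Submodule.add_mem _ h1 h2
    | smul c φ _ h => exact Submodule.smul_mem _ c h


/-- A nonzero subrepresentation contains an irreducible one. -/
theorem exists_irreducible_le {ρ : Representation ℂ G A} [FiniteDimensional ℂ A]
    (N : Subrepresentation ρ) (hN : N.toSubmodule ≠ ⊥) :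
    ∃ S : Subrepresentation ρ, S.toSubmodule ≤ N.toSubmodule ∧
      S.toRepresentation.IsIrreducible := by
  -- A nonzero subrepresentation of least dimension is irreducible.
  obtain ⟨S, ⟨hSN, hS⟩, hmin⟩ := exists_minimalFor_of_wellFoundedLT
    (fun S : Subrepresentation ρ => S.toSubmodule ≤ N.toSubmodule ∧ S.toSubmodule ≠ ⊥)
    (fun S => Module.finrank ℂ S.toSubmodule) ⟨N, le_rfl, hN⟩
  refine ⟨S, hSN, ?_⟩
  have hnt : Nontrivial (Subrepresentation S.toRepresentation) := by
    refine ⟨⊥, ⊤, fun h => hS ?_⟩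
    have h' : (⊥ : Submodule ℂ S.toSubmodule) = ⊤ :=
      congrArg Subrepresentation.toSubmodule h
    rw [Submodule.eq_bot_iff]
    intro x hx
    have : (⟨x, hx⟩ : S.toSubmodule) ∈ (⊥ : Submodule ℂ S.toSubmodule) := h' ▸ Submodule.mem_top
    simpa using this
  refine { hnt with eq_bot_or_eq_top := fun S' => ?_ }
  by_cases hS' : S'.toSubmodule = ⊥
  · exact Or.inl (Subrepresentation.toSubmodule_injective hS')
  right
  let S'' : Subrepresentation ρ :=
    { toSubmodule := S'.toSubmodule.map S.toSubmodule.subtype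
      apply_mem_toSubmodule := by
        rintro g _ ⟨x, hx, rfl⟩
        exact ⟨S.toRepresentation g x, S'.apply_mem_toSubmodule g hx, rfl⟩ }
  have hle : S''.toSubmodule ≤ S.toSubmodule := Submodule.map_subtype_le _ _
  have hne : S''.toSubmodule ≠ ⊥ := fun h => hS' <| by
    exact Submodule.map_injective_of_injective (Submodule.subtype_injective S.toSubmodule)
      (h.trans (Submodule.map_bot _).symm)
  have h1 := hmin ⟨hle.trans hSN, hne⟩ (Submodule.finrank_mono hle)
  have h2 : Module.finrank ℂ S''.toSubmodule = Module.finrank ℂ S'.toSubmodule :=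
    (Submodule.equivMapOfInjective _ (Submodule.subtype_injective _) _).finrank_eq.symm
  apply Subrepresentation.toSubmodule_injective
  exact Submodule.eq_top_of_finrank_eq
    (le_antisymm (Submodule.finrank_le _) (by rw [← h2]; exact h1))

variable [Fintype G] {e : G → ℂ}

theorem kernelAction_comm (he : ∀ g h : G, e (h * g * h⁻¹) = e g) (ρ : Representation ℂ G A)
    (g : G) (v : A) : kernelAction e ρ (ρ g v) = ρ g (kernelAction e ρ v) := by
  rw [kernelAction_apply, kernelAction_apply, map_sum,
    ← Equiv.sum_comp (MulAut.conj g).toEquiv]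
  refine Finset.sum_congr rfl fun k _ => ?_
  simp only [MulEquiv.toEquiv_eq_coe, EquivLike.coe_coe, MulAut.conj_apply, he, map_smul]
  rw [← Module.End.mul_apply, ← Module.End.mul_apply, ← map_mul, ← map_mul]
  simp

theorem kernelAction_intertwining (e : G → ℂ) {ρ : Representation ℂ G A}
    {τ : Representation ℂ G B} (j : Representation.IntertwiningMap ρ τ) (v : A) :
    j (kernelAction e ρ v) = kernelAction e τ (j v) := by
  simp [kernelAction_apply, map_sum, map_smul, Representation.IntertwiningMap.isIntertwining]

theorem coe_kernelAction_toRepresentation (e : G → ℂ) {ρ : Representation ℂ G A}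
    (S : Subrepresentation ρ) (v : S.toSubmodule) :
    (kernelAction e S.toRepresentation v : A) = kernelAction e ρ v := by
  simp [kernelAction_apply, Subrepresentation.toRepresentation]

variable {τ : Representation ℂ G B}

theorem IsProjectionKernel.conv_self {M : Submodule ℂ (G → ℂ)} (he : IsProjectionKernel M e)
    (m : G) : ∑ k, e k * e (k⁻¹ * m) = e m := by
  simpa using he.reproducing _ he.inv_mem m⁻¹

/-- Since e * e = e already in the group algebra, this holds in every representation, related to M
or not. -/
theorem IsProjectionKernel.kernelAction_idem {M : Submodule ℂ (G → ℂ)}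
    (he : IsProjectionKernel M e) (ρ : Representation ℂ G A) (v : A) :
    kernelAction e ρ (kernelAction e ρ v) = kernelAction e ρ v := by
  have h1 : kernelAction e ρ (kernelAction e ρ v) = ∑ k, ∑ m, (e k * e (k⁻¹ * m)) • ρ m v := by
    rw [kernelAction_apply]
    refine Finset.sum_congr rfl fun k _ => ?_
    rw [← Equiv.sum_comp (Equiv.mulLeft k), kernelAction_apply, map_sum, Finset.smul_sum]
    refine Finset.sum_congr rfl fun m _ => ?_
    simp [mul_smul]
  rw [h1, Finset.sum_comm, kernelAction_apply]
  exact Finset.sum_congr rfl fun m _ => by rw [← Finset.sum_smul, he.conv_self]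

theorem IsProjectionKernel.kernelAction_coeff (he : IsProjectionKernel (coeffSpace τ) e) (v : B) :
    kernelAction e τ v = v := by
  refine (Module.forall_dual_apply_eq_zero_iff ℂ _).1 ?_ |> sub_eq_zero.1
  intro l
  have h := he.reproducing _ (coeff_mem_coeffSpace τ l v) 1
  simp only [one_mul, map_one, Module.End.one_apply] at h
  simp [kernelAction_apply, map_sum, map_smul, h]

/-- The average of a linear map over the group is an intertwining map. -/
noncomputable def averageIntertwining (ρ : Representation ℂ G A) (τ : Representation ℂ G B)
    (b : A →ₗ[ℂ] B) : Representation.IntertwiningMap ρ τ :=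
  LinearMap.intertwiningMap_of_isIntertwiningMap ρ τ (∑ k, τ k ∘ₗ b ∘ₗ ρ k⁻¹) fun g v => by
    simp only [LinearMap.sum_apply, LinearMap.comp_apply, map_sum]
    rw [← Equiv.sum_comp (Equiv.mulLeft g)]
    refine Finset.sum_congr rfl fun k _ => ?_
    simp [← Module.End.mul_apply, ← map_mul]

/-- If every averaged rank-one map ρ → τ vanishes, the coefficients of ρ, evaluated at inverses,
pair to zero with all of M. As g ↦ e(g⁻¹) lies in M, e then kills ρ. -/
theorem IsProjectionKernel.exists_average_ne_zero (he : IsProjectionKernel (coeffSpace τ) e)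
    {ρ : Representation ℂ G A} (h : kernelAction e ρ ≠ 0) :
    ∃ j : Representation.IntertwiningMap ρ τ, j ≠ 0 := by
  by_contra! hall
  have hzero : ∀ φ ∈ coeffSpace τ, ∀ (l : Module.Dual ℂ A) (v : A),
      ∑ k, φ k * l (ρ k⁻¹ v) = 0 := fun φ hφ l v => by
    induction hφ using Submodule.span_induction with
    | mem φ h =>
      obtain ⟨x, rfl⟩ := h
      have h1 : averageIntertwining ρ τ (l.smulRight x.2) v = 0 := by
        rw [hall (averageIntertwining ρ τ (l.smulRight x.2))]; rfl
      have h2 : (∑ k, τ k ∘ₗ (l.smulRight x.2) ∘ₗ ρ k⁻¹) v = 0 := h1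
      have h3 := congrArg x.1 h2
      simpa [LinearMap.sum_apply, map_sum, mul_comm] using h3
    | zero => simp
    | add φ ψ _ _ h1 h2 => simp [add_mul, Finset.sum_add_distrib, h1, h2]
    | smul c φ _ h => simp [mul_assoc, ← Finset.mul_sum, h]
  apply h
  ext v
  refine (Module.forall_dual_apply_eq_zero_iff ℂ _).1 fun l => ?_
  have := hzero _ he.inv_mem l v
  rw [← Equiv.sum_comp (Equiv.inv G)] at this
  simpa [kernelAction_apply, map_sum] using this

theorem irrepsSubset_iff (he : IsProjectionKernel (coeffSpace τ) e) [FiniteDimensional ℂ A]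
    (ρ : Representation ℂ G A) : IrrepsSubset ρ τ ↔ ∀ v, kernelAction e ρ v = v := by
  constructor
  · intro h
    let N : Subrepresentation ρ :=
      { toSubmodule := LinearMap.ker (kernelAction e ρ)
        apply_mem_toSubmodule := fun g v hv => by
          rw [LinearMap.mem_ker] at hv ⊢
          rw [kernelAction_comm he.conj_inv, hv, map_zero] }
    -- An irreducible inside the kernel would embed in τ, where e is the identity. An injective
    -- idempotent is the identity.
    have hN : LinearMap.ker (kernelAction e ρ) = ⊥ := by
      by_contra hN
      obtain ⟨S, hSN, hS⟩ := exists_irreducible_le N hN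
      obtain ⟨j, hj⟩ := h S hS
      have hS0 : ∀ s : S.toSubmodule, s = 0 := fun s => by
        have h1 : kernelAction e S.toRepresentation s = s := hj <| by
          rw [kernelAction_intertwining, he.kernelAction_coeff]
        have h2 : kernelAction e ρ (s : A) = 0 := hSN s.2
        rw [← coe_kernelAction_toRepresentation, h1] at h2
        exact_mod_cast h2
      have : (⊥ : Subrepresentation S.toRepresentation) = ⊤ := by
        apply Subrepresentation.toSubmodule_injective
        ext s
        simp [hS0 s]
      exact bot_ne_top this
    rw [LinearMap.ker_eq_bot] at hN
    exact fun v => hN (he.kernelAction_idem ρ v)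
  · intro h S hS
    have hne : kernelAction e S.toRepresentation ≠ 0 := fun h0 => by
      have : (⊥ : Subrepresentation S.toRepresentation) = ⊤ := by
        apply Subrepresentation.toSubmodule_injective
        ext s
        have h1 := coe_kernelAction_toRepresentation e S s
        rw [h0, h] at h1
        have h2 : s = 0 := Subtype.ext h1.symm
        simp [h2]
      exact bot_ne_top this
    obtain ⟨j, hj⟩ := he.exists_average_ne_zero hne
    exact ⟨j, (Representation.IsIrreducible.injective_or_eq_zero j).resolve_right hj⟩

theorem sharedPart_eq_range (he : IsProjectionKernel (coeffSpace τ) e) [FiniteDimensional ℂ A]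
    (ρ : Representation ℂ G A) : sharedPart ρ τ = LinearMap.range (kernelAction e ρ) := by
  apply le_antisymm
  · refine iSup_le fun S v hv => ?_
    have h := (irrepsSubset_iff he _).1 S.2 ⟨v, hv⟩
    have h2 := coe_kernelAction_toRepresentation e S.1 ⟨v, hv⟩
    rw [h] at h2
    exact ⟨v, h2.symm⟩
  · let S : Subrepresentation ρ :=
      { toSubmodule := LinearMap.range (kernelAction e ρ)
        apply_mem_toSubmodule := by
          rintro g _ ⟨v, rfl⟩
          exact ⟨ρ g v, kernelAction_comm he.conj_inv _ _ _⟩ }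
    have hS : IrrepsSubset S.toRepresentation τ := by
      rw [irrepsSubset_iff he]
      rintro ⟨_, v, rfl⟩
      apply Subtype.ext
      rw [coe_kernelAction_toRepresentation]
      exact he.kernelAction_idem ρ v
    exact le_iSup (fun S : {S : Subrepresentation ρ // IrrepsSubset S.toRepresentation τ} =>
      S.1.toSubmodule) ⟨S, hS⟩

/-- The trace of a projection is its rank; this makes the shared dimension computable on an induced
representation. -/
theorem finrank_sharedPart (he : IsProjectionKernel (coeffSpace τ) e) [FiniteDimensional ℂ A]
    (ρ : Representation ℂ G A) :
    (Module.finrank ℂ (sharedPart ρ τ) : ℂ) = LinearMap.trace ℂ A (kernelAction e ρ) := by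
  have h : LinearMap.IsProj (LinearMap.range (kernelAction e ρ)) (kernelAction e ρ) :=
    ⟨fun x => ⟨x, rfl⟩, by rintro _ ⟨v, rfl⟩; exact he.kernelAction_idem ρ v⟩
  rw [sharedPart_eq_range he, h.trace]

end KernelAction

/-! ### The trace of a class function on an induced representation -/

section Induced

open Representation

theorem trace_pi_eq_sum {ι W : Type*} [Fintype ι] [DecidableEq ι] [AddCommGroup W] [Module ℂ W]
    [FiniteDimensional ℂ W] (T : (ι → W) →ₗ[ℂ] (ι → W)) :
    LinearMap.trace ℂ (ι → W) T = ∑ i, LinearMap.trace ℂ W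
      (LinearMap.proj i ∘ₗ T ∘ₗ LinearMap.single ℂ (fun _ => W) i) := by
  have h : T = ∑ i, (T ∘ₗ LinearMap.single ℂ (fun _ => W) i) ∘ₗ LinearMap.proj i := by
    refine LinearMap.ext fun f => ?_
    conv_lhs => rw [← Finset.univ_sum_single f]
    simp [LinearMap.sum_apply, map_sum]
  conv_lhs => rw [h]
  rw [map_sum]
  exact Finset.sum_congr rfl fun i _ => LinearMap.trace_comp_comm' _ _

variable {G : Type*} [Group G] {H : Subgroup G} {W : Type*} [AddCommGroup W] [Module ℂ W]
  (Y : Representation ℂ H W)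

theorem indV_mk_mul (h : H) (x : G) (a : W) :
    IndV.mk H.subtype Y (h * x) (Y h a) = IndV.mk H.subtype Y x a := by
  have := Coinvariants.mk_self_apply (Representation.tprod ((leftRegular ℂ G).comp H.subtype) Y) h
    (TensorProduct.tmul ℂ (MonoidAlgebra.single x 1) a)
  simpa using this

open Classical in
/-- The averaging map underlying `funOfInd`. -/
noncomputable def averageFun [Fintype H] : (MonoidAlgebra ℂ G) ⊗[ℂ] W →ₗ[ℂ] (G → W) :=
  LinearMap.pi fun g => (Fintype.card H : ℂ)⁻¹ • ∑ h : H, Y h ∘ₗ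
    TensorProduct.lift (LinearMap.lsmul ℂ W ∘ₗ Finsupp.lapply ((h : G)⁻¹ * g) ∘ₗ
      (MonoidAlgebra.coeffLinearEquiv ℂ).toLinearMap)

open Classical in
theorem averageFun_single_tmul [Fintype H] (x : G) (a : W) (g : G) :
    averageFun Y (TensorProduct.tmul ℂ (MonoidAlgebra.single x 1) a) g =
      (Fintype.card H : ℂ)⁻¹ • ∑ h : H, if (h : G) * x = g then Y h a else 0 := by
  simp only [averageFun, LinearMap.pi_apply, LinearMap.smul_apply, LinearMap.sum_apply]
  congr 1
  refine Finset.sum_congr rfl fun h _ => ?_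
  simp [Finsupp.single_apply, eq_inv_mul_iff_mul_eq, apply_ite (Y h)]

open Classical in
/-- The section of `indOfFun` given by averaging over the subgroup. -/
noncomputable def funOfInd [Fintype H] : IndV H.subtype Y →ₗ[ℂ] (G → W) :=
  Coinvariants.lift _ (averageFun Y) fun h' => by
    refine TensorProduct.ext <| MonoidAlgebra.lhom_ext' fun x => LinearMap.ext_ring ?_
    ext a g
    simp only [LinearMap.compr₂ₛₗ_apply, LinearMap.coe_comp, Function.comp_apply,
      TensorProduct.mk_apply, MonoidAlgebra.lsingle_apply, Representation.tprod_apply,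
      TensorProduct.map_tmul, MonoidHom.coe_comp, Subgroup.coe_subtype]
    rw [leftRegular, ofMulAction_single, averageFun_single_tmul, averageFun_single_tmul]
    conv_rhs => rw [← Equiv.sum_comp (Equiv.mulRight h')]
    congr 1
    refine Finset.sum_congr rfl fun h _ => ?_
    simp only [Equiv.coe_mulRight, Subgroup.coe_mul, map_mul, Module.End.mul_apply, smul_eq_mul]
    exact if_congr (by rw [mul_assoc]) rfl rfl

open Classical in
theorem funOfInd_mk [Fintype H] (x : G) (a : W) (g : G) :
    funOfInd Y (IndV.mk H.subtype Y x a) g =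
      (Fintype.card H : ℂ)⁻¹ • ∑ h : H, if (h : G) * x = g then Y h a else 0 :=
  averageFun_single_tmul Y x a g

variable [Fintype G]

/-- The map `f ↦ ∑ x, ⟦x ⊗ f x⟧` onto the induced representation. -/
noncomputable def indOfFun : (G → W) →ₗ[ℂ] IndV H.subtype Y :=
  ∑ x, IndV.mk H.subtype Y x ∘ₗ LinearMap.proj x

theorem indOfFun_apply (f : G → W) : indOfFun Y f = ∑ x, IndV.mk H.subtype Y x (f x) := by
  simp [indOfFun, LinearMap.sum_apply]

theorem kernelAction_ind_mk (e : G → ℂ) (x : G) (a : W) :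
    kernelAction e (ind H.subtype Y) (IndV.mk H.subtype Y x a) =
      ∑ k, e k • IndV.mk H.subtype Y (x * k⁻¹) a := by
  simp only [kernelAction_apply, ind_mk]

theorem kernelAction_ind_indOfFun (e : G → ℂ) (f : G → W) :
    kernelAction e (ind H.subtype Y) (indOfFun Y f) =
      indOfFun Y (fun g => ∑ k, e k • f (g * k)) := by
  simp only [indOfFun_apply, map_sum, kernelAction_ind_mk, map_smul]
  rw [Finset.sum_comm, Finset.sum_comm (s := Finset.univ (α := G)) (t := Finset.univ (α := G))]
  conv_rhs => rw [Finset.sum_comm]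
  conv_lhs => rw [Finset.sum_comm]
  refine Finset.sum_congr rfl fun k _ => ?_
  rw [← Equiv.sum_comp (Equiv.mulRight k)]
  simp

variable [Fintype H]

/-- The induced space is thus a retract of G → W, where traces can be read off block by block
without choosing coset representatives. -/
theorem indOfFun_funOfInd (v : IndV H.subtype Y) : indOfFun Y (funOfInd Y v) = v := by
  classical
  have : indOfFun Y ∘ₗ funOfInd Y = LinearMap.id := by
    refine IndV.hom_ext _ _ fun x => LinearMap.ext fun a => ?_
    change indOfFun Y (funOfInd Y (IndV.mk H.subtype Y x a)) = IndV.mk H.subtype Y x a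
    rw [indOfFun_apply]
    simp only [funOfInd_mk, map_smul, map_sum]
    rw [← Finset.smul_sum, Finset.sum_comm]
    have h1 : ∀ h : H, ∑ g, IndV.mk H.subtype Y g (if (h : G) * x = g then Y h a else 0) =
        IndV.mk H.subtype Y x a := fun h => by
      rw [Finset.sum_eq_single ((h : G) * x)]
      · rw [if_pos rfl, indV_mk_mul]
      · intro g _ hg
        rw [if_neg (Ne.symm hg), map_zero]
      · simp
    simp only [h1, Finset.sum_const, Finset.card_univ]
    rw [← Nat.cast_smul_eq_nsmul ℂ, smul_smul, inv_mul_cancel₀ (by simp), one_smul]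
  exact LinearMap.congr_fun this v

theorem trace_kernelAction_ind [FiniteDimensional ℂ W] {e : G → ℂ}
    (he : ∀ g h : G, e (h * g * h⁻¹) = e g) {c : ℂ}
    (hc : ∀ w, kernelAction (fun h : H => e h) Y w = c • w) :
    LinearMap.trace ℂ _ (kernelAction e (ind H.subtype Y)) =
      Fintype.card G * ((Fintype.card H : ℂ)⁻¹ * (c * Module.finrank ℂ W)) := by
  classical
  let E : (G → W) →ₗ[ℂ] (G → W) := LinearMap.pi fun g => ∑ k, e k • LinearMap.proj (g * k)
  have hE : ∀ f g, E f g = ∑ k, e k • f (g * k) := fun f g => by simp [E, LinearMap.sum_apply]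
  have h1 : kernelAction e (ind H.subtype Y) = indOfFun Y ∘ₗ (E ∘ₗ funOfInd Y) := by
    refine LinearMap.ext fun v => ?_
    conv_lhs => rw [← indOfFun_funOfInd Y v, kernelAction_ind_indOfFun]
    simp only [LinearMap.comp_apply]
    congr 1
    funext g
    rw [hE]
  have h2 : ∀ g : G, LinearMap.proj g ∘ₗ ((E ∘ₗ funOfInd Y) ∘ₗ indOfFun Y) ∘ₗ
      LinearMap.single ℂ (fun _ => W) g = ((Fintype.card H : ℂ)⁻¹ * c) • LinearMap.id := by
    intro g
    refine LinearMap.ext fun w => ?_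
    have h3 : indOfFun Y (Pi.single g w) = IndV.mk H.subtype Y g w := by
      rw [indOfFun_apply, Finset.sum_eq_single g]
      · simp
      · intro x _ hx
        simp [hx]
      · simp
    change E (funOfInd Y (indOfFun Y (Pi.single g w))) g = ((Fintype.card H : ℂ)⁻¹ * c) • w
    rw [h3, hE, mul_smul]
    simp only [funOfInd_mk]
    rw [← hc, kernelAction_apply, Finset.smul_sum]
    simp only [Finset.smul_sum]
    rw [Finset.sum_comm]
    refine Finset.sum_congr rfl fun h _ => ?_
    -- The diagonal block at g only sees k with h g = g k, and invariance under conjugation turns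
    -- e(g⁻¹hg) into e(h). Every block is therefore the same scalar.
    rw [Finset.sum_eq_single (g⁻¹ * h * g)]
    · have := he h g⁻¹
      rw [inv_inv] at this
      rw [if_pos (by group), this, smul_comm]
    · intro k _ hk
      rw [if_neg, smul_zero, smul_zero]
      intro h4
      apply hk
      rw [mul_assoc, h4]; group
    · simp
  rw [h1, LinearMap.trace_comp_comm', trace_pi_eq_sum]
  simp only [h2, map_smul, LinearMap.trace_id, Finset.sum_const, Finset.card_univ, smul_eq_mul,
    nsmul_eq_mul]
  ring

theorem finrank_indV [FiniteDimensional ℂ W] :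
    (Module.finrank ℂ (IndV H.subtype Y) : ℂ) =
      Fintype.card G * ((Fintype.card H : ℂ)⁻¹ * Module.finrank ℂ W) := by
  classical
  -- The delta function at 1 acts as the identity, so its trace is the dimension.
  have h := trace_kernelAction_ind (e := fun g : G => if g = 1 then (1 : ℂ) else 0) Y
    (fun g h => by simp [mul_inv_eq_one]) (c := 1) (fun w => by simp [kernelAction_apply])
  have h1 : kernelAction (fun g : G => if g = 1 then (1 : ℂ) else 0) (ind H.subtype Y) =
      LinearMap.id := by
    refine LinearMap.ext fun w => ?_
    simp only [kernelAction_apply, ite_smul, one_smul, zero_smul, Finset.sum_ite_eq',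
      Finset.mem_univ, if_true, map_one, Module.End.one_apply, LinearMap.id_apply]
  rw [h1, LinearMap.trace_id] at h
  rw [h, one_mul]

end Induced

/-! ### Irreducible representations of the subgroup and the localisation inequality -/

section Irreducible

variable {H : Type*} [Group H] {A B : Type*} [AddCommGroup A] [Module ℂ A]
  [AddCommGroup B] [Module ℂ B]

/-- Transport of a representation along a linear equivalence. -/
def conjRep (ρ : Representation ℂ H A) (L : A ≃ₗ[ℂ] B) : Representation ℂ H B :=
  (L.conjAlgEquiv ℂ : Module.End ℂ A →* Module.End ℂ B).comp ρ

theorem conjRep_apply (ρ : Representation ℂ H A) (L : A ≃ₗ[ℂ] B) (h : H) (b : B) :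
    conjRep ρ L h b = L (ρ h (L.symm b)) := rfl

/-- Transport of subrepresentations along a linear equivalence. -/
def subrepresentationConj (ρ : Representation ℂ H A) (L : A ≃ₗ[ℂ] B) :
    Subrepresentation (conjRep ρ L) ≃o Subrepresentation ρ where
  toFun S := ⟨S.toSubmodule.comap L.toLinearMap, fun g v hv => by
    have := S.apply_mem_toSubmodule g hv
    simpa [conjRep_apply] using this⟩
  invFun S := ⟨S.toSubmodule.comap L.symm.toLinearMap, fun g v hv => by
    have := S.apply_mem_toSubmodule g hv
    simpa [conjRep_apply] using this⟩
  left_inv S := by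
    apply Subrepresentation.toSubmodule_injective
    ext; simp
  right_inv S := by
    apply Subrepresentation.toSubmodule_injective
    ext; simp
  map_rel_iff' {S S'} := by
    constructor
    · intro h x hx
      have h1 : L (L.symm x) ∈ S := by rwa [L.apply_symm_apply]
      have h2 : L (L.symm x) ∈ S' := h h1
      rwa [L.apply_symm_apply] at h2
    · intro h x hx
      exact h hx

theorem conjRep_isIrreducible {ρ : Representation ℂ H A} (hρ : ρ.IsIrreducible) (L : A ≃ₗ[ℂ] B) :
    (conjRep ρ L).IsIrreducible :=
  (OrderIso.isSimpleOrder_iff (subrepresentationConj ρ L)).2 hρ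

theorem nontrivial_of_isIrreducible {ρ : Representation ℂ H A} (hρ : ρ.IsIrreducible) :
    Nontrivial A := by
  by_contra h
  rw [not_nontrivial_iff_subsingleton] at h
  exact bot_ne_top (α := Subrepresentation ρ) <|
    Subrepresentation.toSubmodule_injective (Subsingleton.elim _ _)

theorem span_orbit_eq_top {ρ : Representation ℂ H A} (hρ : ρ.IsIrreducible) {w : A} (hw : w ≠ 0) :
    Submodule.span ℂ (Set.range fun h => ρ h w) = ⊤ := by
  let S : Subrepresentation ρ :=
    { toSubmodule := Submodule.span ℂ (Set.range fun h => ρ h w)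
      apply_mem_toSubmodule := fun g v hv => by
        induction hv using Submodule.span_induction with
        | mem v h =>
          obtain ⟨x, rfl⟩ := h
          exact Submodule.subset_span ⟨g * x, by simp⟩
        | zero => simp
        | add φ ψ _ _ h1 h2 => rw [map_add]; exact Submodule.add_mem _ h1 h2
        | smul c φ _ h => rw [map_smul]; exact Submodule.smul_mem _ c h }
  rcases eq_bot_or_eq_top S with h | h
  · have h1 : w ∈ S.toSubmodule := Submodule.subset_span ⟨1, by simp⟩
    rw [h] at h1
    exact absurd ((Submodule.mem_bot ℂ).1 h1) hw
  · exact congrArg Subrepresentation.toSubmodule h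

theorem finiteDimensional_of_isIrreducible [Finite H] {ρ : Representation ℂ H A}
    (hρ : ρ.IsIrreducible) : FiniteDimensional ℂ A := by
  obtain ⟨w, hw⟩ := @exists_ne _ (nontrivial_of_isIrreducible hρ) (0 : A)
  refine ⟨?_⟩
  rw [← span_orbit_eq_top hρ hw]
  exact Submodule.fg_span (Set.finite_range _)

theorem finrank_le_card_of_isIrreducible [Fintype H] {ρ : Representation ℂ H A}
    (hρ : ρ.IsIrreducible) : Module.finrank ℂ A ≤ Fintype.card H := by
  obtain ⟨w, hw⟩ := @exists_ne _ (nontrivial_of_isIrreducible hρ) (0 : A)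
  rw [← finrank_top, ← span_orbit_eq_top hρ hw]
  exact finrank_range_le_card _

theorem kernelAction_conjRep [Fintype H] (e : H → ℂ) (ρ : Representation ℂ H A) (L : A ≃ₗ[ℂ] B)
    (b : B) : kernelAction e (conjRep ρ L) b = L (kernelAction e ρ (L.symm b)) := by
  simp [kernelAction_apply, conjRep_apply]

/-- Schur's lemma for the action of class functions. -/
theorem exists_kernelAction_eq_smul [Fintype H] {e : H → ℂ}
    (he : ∀ g h : H, e (h * g * h⁻¹) = e g) {ρ : Representation ℂ H A} (hρ : ρ.IsIrreducible) :
    ∃ c : ℂ, ∀ v, kernelAction e ρ v = c • v := by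
  have := finiteDimensional_of_isIrreducible hρ
  let j : Representation.IntertwiningMap ρ ρ :=
    LinearMap.intertwiningMap_of_isIntertwiningMap ρ ρ (kernelAction e ρ)
      (kernelAction_comm he ρ)
  obtain ⟨c, hc⟩ :=
    (Representation.IsIrreducible.algebraMap_intertwiningMap_bijective_of_isAlgClosed
      (ρ := ρ)).2 j
  refine ⟨c, fun v => ?_⟩
  have h1 : j v = (algebraMap ℂ (Representation.IntertwiningMap ρ ρ) c) v := by rw [hc]
  rw [Algebra.algebraMap_eq_smul_one] at h1
  exact h1

/-- Right translation on `L²(H)`. -/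
noncomputable def rightRegular (H : Type*) [Group H] :
    Representation ℂ H (EuclideanSpace ℂ H) where
  toFun h := (WithLp.linearEquiv 2 ℂ (H → ℂ)).symm.toLinearMap ∘ₗ
    LinearMap.funLeft ℂ ℂ (fun k => k * h) ∘ₗ (WithLp.linearEquiv 2 ℂ (H → ℂ)).toLinearMap
  map_one' := by ext; simp [LinearMap.funLeft]
  map_mul' g h := by ext; simp [LinearMap.funLeft, mul_assoc]

@[simp]
theorem rightRegular_apply (h : H) (φ : EuclideanSpace ℂ H) (k : H) :
    rightRegular H h φ k = φ (k * h) := rfl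

variable [Fintype H]

theorem inner_rightRegular (h : H) (φ ψ : EuclideanSpace ℂ H) :
    inner ℂ φ (rightRegular H h ψ) = inner ℂ (rightRegular H h⁻¹ φ) ψ := by
  rw [PiLp.inner_apply, PiLp.inner_apply, ← Equiv.sum_comp (Equiv.mulRight h⁻¹)]
  simp

theorem isSymmetric_kernelAction {e : H → ℂ} (he : ∀ g, e g⁻¹ = starRingEnd ℂ (e g)) :
    (kernelAction e (rightRegular H)).IsSymmetric := fun φ ψ => by
  simp only [kernelAction_apply, sum_inner, inner_sum, inner_smul_left, inner_smul_right,
    inner_rightRegular, ← he]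
  rw [← Equiv.sum_comp (Equiv.inv H)]
  simp

theorem _root_.LinearMap.IsSymmetric.re_inner_eq_sum {E : Type*} [NormedAddCommGroup E]
    [InnerProductSpace ℂ E] [FiniteDimensional ℂ E] {T : E →ₗ[ℂ] E} (hT : T.IsSymmetric) {n : ℕ}
    (hn : Module.finrank ℂ E = n) (v : E) :
    (inner ℂ v (T v)).re =
      ∑ i, hT.eigenvalues hn i * ‖inner ℂ (hT.eigenvectorBasis hn i) v‖ ^ 2 := by
  rw [← (hT.eigenvectorBasis hn).sum_inner_mul_inner v (T v), Complex.re_sum]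
  refine Finset.sum_congr rfl fun i _ => ?_
  have h1 : inner ℂ (hT.eigenvectorBasis hn i) (T v) =
      hT.eigenvalues hn i * inner ℂ (hT.eigenvectorBasis hn i) v := by
    rw [← hT, hT.apply_eigenvectorBasis, inner_smul_left]
    simp
  rw [h1, ← inner_conj_symm, mul_left_comm, Complex.conj_mul', ← Complex.ofReal_pow,
    ← Complex.ofReal_mul, Complex.ofReal_re]

/-- If `d` bounds the scalars by which `e` acts on the irreducible representations, then it bounds
the quadratic form of `e` on `L²(H)`. -/
theorem re_inner_kernelAction_le {e : H → ℂ} (hconj : ∀ g h : H, e (h * g * h⁻¹) = e g)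
    (he : ∀ g, e g⁻¹ = starRingEnd ℂ (e g)) {d : ℝ}
    (hd : ∀ (n : ℕ) (Y : Representation ℂ H (Fin n → ℂ)) (c : ℝ), Y.IsIrreducible →
      (∀ w, kernelAction e Y w = (c : ℂ) • w) → c ≤ d) (φ : EuclideanSpace ℂ H) :
    (inner ℂ φ (kernelAction e (rightRegular H) φ)).re ≤ d * ‖φ‖ ^ 2 := by
  have hT := isSymmetric_kernelAction he
  rw [hT.re_inner_eq_sum rfl, ← (hT.eigenvectorBasis rfl).sum_sq_norm_inner_right φ,
    Finset.mul_sum]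
  refine Finset.sum_le_sum fun i _ => mul_le_mul_of_nonneg_right ?_ (by positivity)
  let c := hT.eigenvalues rfl i
  -- As e is a class function, its eigenspaces are subrepresentations. An irreducible inside one is
  -- acted on by the eigenvalue, so `hd` bounds that eigenvalue.
  let N : Subrepresentation (rightRegular H) :=
    { toSubmodule := Module.End.eigenspace (kernelAction e (rightRegular H)) (c : ℂ)
      apply_mem_toSubmodule := fun g v hv => by
        rw [Module.End.mem_eigenspace_iff] at hv ⊢
        rw [kernelAction_comm hconj, hv, map_smul] }
  have hN : N.toSubmodule ≠ ⊥ := by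
    rw [Submodule.ne_bot_iff]
    exact ⟨hT.eigenvectorBasis rfl i,
      Module.End.mem_eigenspace_iff.2 (hT.apply_eigenvectorBasis rfl i),
      (hT.eigenvectorBasis rfl).orthonormal.ne_zero i⟩
  obtain ⟨S, hSN, hS⟩ := exists_irreducible_le N hN
  let L := (Module.finBasis ℂ S.toSubmodule).equivFun
  refine hd _ (conjRep S.toRepresentation L) c (conjRep_isIrreducible hS L) fun w => ?_
  rw [kernelAction_conjRep]
  have h1 : kernelAction e S.toRepresentation (L.symm w) = (c : ℂ) • L.symm w := by
    apply Subtype.ext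
    rw [coe_kernelAction_toRepresentation]
    exact Module.End.mem_eigenspace_iff.1 (hSN (L.symm w).2)
  rw [h1, map_smul, LinearEquiv.apply_symm_apply]

end Irreducible

/-! ### Mass on a subgroup of functions in a bi-invariant space -/

section Localisation

variable {G : Type*} [Group G] {H : Subgroup G} [Fintype H]
  {M : Submodule ℂ (G → ℂ)} {e : G → ℂ}

/-- The projection to `M` of a function supported on `H`. -/
noncomputable def projectFun (e : G → ℂ) (η : H → ℂ) (g : G) : ℂ := ∑ h : H, e (g⁻¹ * h) * η h

/-- Projecting to M and restricting back to H is the action of e|_H by right translation on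
functions on H. -/
theorem projectFun_coe (η : H → ℂ) (h : H) : projectFun e η h = ∑ k : H, e k * η (h * k) := by
  rw [projectFun, ← Equiv.sum_comp (Equiv.mulLeft h)]
  simp

variable [Fintype G]

theorem projectFun_mem (hM : IsBiInvariant M) (he : IsProjectionKernel M e) (η : H → ℂ) :
    projectFun e η ∈ M := by
  have h1 : projectFun e η = ∑ h : H, η h • fun g => e ((h : G)⁻¹ * g)⁻¹ := by
    funext g
    simp [projectFun, mul_comm]
  rw [h1]
  exact Submodule.sum_mem _ fun h _ => Submodule.smul_mem _ _ (hM.left _ he.inv_mem _)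

/-- ‖P_M η‖² = ⟨η, P_M η⟩, and only values on H enter the right-hand side because η lives there. -/
theorem sum_sq_projectFun (he : IsProjectionKernel M e) (η : H → ℂ) :
    ((∑ g, ‖projectFun e η g‖ ^ 2 : ℝ) : ℂ) =
      ∑ h : H, starRingEnd ℂ (η h) * ∑ k : H, e k * η (h * k) := by
  have h1 : ∀ g, ((‖projectFun e η g‖ ^ 2 : ℝ) : ℂ) = ∑ h : H, ∑ h' : H,
      starRingEnd ℂ (η h) * (η h' * (e ((h : G)⁻¹ * g) * e (g⁻¹ * h'))) := fun g => by
    rw [Complex.ofReal_pow, ← Complex.conj_mul', projectFun, map_sum, Finset.sum_mul_sum]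
    refine Finset.sum_congr rfl fun h _ => Finset.sum_congr rfl fun h' _ => ?_
    rw [map_mul, ← he.map_inv]
    simp only [mul_inv_rev, inv_inv]
    ring
  rw [Complex.ofReal_sum]
  simp only [h1]
  rw [Finset.sum_comm]
  refine Finset.sum_congr rfl fun h _ => ?_
  rw [Finset.sum_comm, ← projectFun_coe, projectFun, Finset.mul_sum]
  refine Finset.sum_congr rfl fun h' _ => ?_
  rw [← Finset.mul_sum, ← Finset.mul_sum, ← Equiv.sum_comp (Equiv.mulLeft (h : G))]
  have h2 := he.conv_self ((h : G)⁻¹ * h')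
  simp only [Equiv.coe_mulLeft, inv_mul_cancel_left, mul_inv_rev, mul_assoc]
  rw [h2]
  ring

/-- The localisation inequality: a function in `M` has at most the fraction `d` of its `L²`-mass
on `H`. -/
theorem sum_subgroup_le (he : IsProjectionKernel M e) {d : ℝ} (hd0 : 0 ≤ d)
    (hd : ∀ (n : ℕ) (Y : Representation ℂ H (Fin n → ℂ)) (c : ℝ), Y.IsIrreducible →
      (∀ w, kernelAction (fun h : H => e h) Y w = (c : ℂ) • w) → c ≤ d)
    {φ : G → ℂ} (hφ : φ ∈ M) : ∑ h : H, ‖φ h‖ ^ 2 ≤ d * ∑ g, ‖φ g‖ ^ 2 := by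
  set η : H → ℂ := fun h => φ h with hη
  set ψ := projectFun e η with hψ
  set a := ∑ h : H, ‖φ h‖ ^ 2 with ha
  have ha0 : 0 ≤ a := Finset.sum_nonneg fun _ _ => by positivity
  have h1 : ∑ g, ‖ψ g‖ ^ 2 ≤ d * a := by
    have h2 := re_inner_kernelAction_le (e := fun h : H => e h)
      (fun g h => by simpa using he.conj_inv g h) (fun g => by simpa using he.map_inv g) hd
      (WithLp.toLp 2 η)
    have h3 : inner ℂ (WithLp.toLp 2 η)
        (kernelAction (fun h : H => e h) (rightRegular H) (WithLp.toLp 2 η)) =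
        ((∑ g, ‖ψ g‖ ^ 2 : ℝ) : ℂ) := by
      rw [hψ, sum_sq_projectFun he, PiLp.inner_apply]
      refine Finset.sum_congr rfl fun h _ => ?_
      simp [kernelAction_apply, mul_comm]
    rw [h3, Complex.ofReal_re, EuclideanSpace.norm_sq_eq] at h2
    exact h2
  -- Since φ = P_M φ, the mass of φ on H is ⟨η, φ⟩ = ⟨P_M η, φ⟩. Cauchy–Schwarz then gives a² ≤ (d
  -- a) ‖φ‖², and a cancels.
  have h4 : (a : ℂ) = ∑ g, starRingEnd ℂ (ψ g) * φ g := by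
    rw [ha, Complex.ofReal_sum]
    have h5 : ∀ h : H, ((‖φ h‖ ^ 2 : ℝ) : ℂ) =
        ∑ g, starRingEnd ℂ (η h) * (e ((h : G)⁻¹ * g) * φ g) := fun h => by
      rw [Complex.ofReal_pow, ← Complex.conj_mul', ← Finset.mul_sum,
        ← Equiv.sum_comp (Equiv.mulLeft (h : G))]
      simp only [Equiv.coe_mulLeft, inv_mul_cancel_left]
      rw [he.reproducing φ hφ]
    simp only [h5]
    rw [Finset.sum_comm]
    refine Finset.sum_congr rfl fun g _ => ?_
    rw [hψ, projectFun, map_sum, Finset.sum_mul]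
    refine Finset.sum_congr rfl fun h _ => ?_
    rw [map_mul, ← he.map_inv]
    simp only [mul_inv_rev, inv_inv]
    ring
  have h6 : a ≤ ∑ g, ‖ψ g‖ * ‖φ g‖ := by
    have : a = ‖(a : ℂ)‖ := by simp [abs_of_nonneg ha0]
    rw [this, h4]
    refine (norm_sum_le _ _).trans (le_of_eq ?_)
    simp
  have h7 := Finset.sum_mul_sq_le_sq_mul_sq Finset.univ (fun g => ‖ψ g‖) (fun g => ‖φ g‖)
  have hb0 : 0 ≤ ∑ g, ‖φ g‖ ^ 2 := Finset.sum_nonneg fun _ _ => by positivity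
  have h8 : a ^ 2 ≤ (d * a) * ∑ g, ‖φ g‖ ^ 2 :=
    (pow_le_pow_left₀ ha0 h6 2).trans (h7.trans (mul_le_mul_of_nonneg_right h1 hb0))
  rcases ha0.eq_or_lt with h0 | h0
  · rw [← h0]; positivity
  · refine le_of_mul_le_mul_left ?_ h0
    linarith

/-- The localisation inequality is attained. -/
theorem exists_sum_subgroup_eq (hM : IsBiInvariant M) (he : IsProjectionKernel M e) {W : Type*}
    [AddCommGroup W] [Module ℂ W] {Y : Representation ℂ H W} [Nontrivial W] {c : ℝ} (hc : 0 < c)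
    (hY : ∀ w, kernelAction (fun h : H => e h) Y w = (c : ℂ) • w) :
    ∃ φ ∈ M, ∑ g, ‖φ g‖ ^ 2 = 1 ∧ ∑ h : H, ‖φ h‖ ^ 2 = c := by
  obtain ⟨w, hw⟩ := exists_ne (0 : W)
  obtain ⟨l, hl⟩ := Module.Projective.exists_dual_ne_zero ℂ hw
  -- A matrix coefficient of Y is an eigenvector of the compression with eigenvalue c. Its
  -- projection has total mass c b and mass c² b on H, so the ratio is c.
  set η : H → ℂ := fun h => l (Y h w) with hη
  have h1 : ∀ h : H, ∑ k : H, e k * η (h * k) = c * η h := fun h => by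
    have h2 := congrArg (fun v => l (Y h v)) (hY w)
    simpa [kernelAction_apply, map_sum, hη] using h2
  set b := ∑ h : H, ‖η h‖ ^ 2 with hb
  have hb0 : 0 < b := Finset.sum_pos' (fun _ _ => by positivity)
    ⟨1, Finset.mem_univ _, pow_pos (norm_pos_iff.2 (by simpa [hη] using hl)) 2⟩
  have h3 : ∑ g, ‖projectFun e η g‖ ^ 2 = c * b := by
    apply Complex.ofReal_injective
    rw [sum_sq_projectFun he, Complex.ofReal_mul, hb, Complex.ofReal_sum, Finset.mul_sum]
    refine Finset.sum_congr rfl fun h _ => ?_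
    rw [h1, Complex.ofReal_pow, ← Complex.conj_mul']
    ring
  have h4 : ∑ h : H, ‖projectFun e η h‖ ^ 2 = c ^ 2 * b := by
    rw [hb, Finset.mul_sum]
    refine Finset.sum_congr rfl fun h _ => ?_
    rw [projectFun_coe, h1, norm_mul, mul_pow]
    simp
  have hs : Real.sqrt (c * b) ^ 2 = c * b := Real.sq_sqrt (by positivity)
  refine ⟨((Real.sqrt (c * b))⁻¹ : ℂ) • projectFun e η,
    M.smul_mem _ (projectFun_mem hM he η), ?_, ?_⟩
  · simp only [Pi.smul_apply, norm_smul, mul_pow, norm_inv, Complex.norm_real, inv_pow,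
      Real.norm_eq_abs, sq_abs, hs, ← Finset.mul_sum, h3]
    exact inv_mul_cancel₀ (by positivity)
  · simp only [Pi.smul_apply, norm_smul, mul_pow, norm_inv, Complex.norm_real, inv_pow,
      Real.norm_eq_abs, sq_abs, hs, ← Finset.mul_sum, h4]
    field_simp

end Localisation

/-! ### The shared fractions -/

section SharedFraction

open Representation

variable {G : Type*} [Group G] {H : Subgroup G}
  {V : Type*} [NormedAddCommGroup V] [InnerProductSpace ℂ V] (π : G →* (V ≃ₗᵢ[ℂ] V)) {t : ℕ}

theorem sharedFraction_nonneg {W : Type*} [AddCommGroup W] [Module ℂ W]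
    (Y : Representation ℂ H W) : 0 ≤ sharedFraction π t Y := by
  unfold sharedFraction; positivity

variable (H t) in
theorem sharedFractions_nonempty : (sharedFractions π H t).Nonempty := by
  obtain ⟨S, -, hS⟩ := exists_irreducible_le (ρ := Representation.trivial ℂ H ℂ) ⊤ top_ne_bot
  let L := (Module.finBasis ℂ S.toSubmodule).equivFun
  exact ⟨_, _, inferInstance, inferInstance, conjRep S.toRepresentation L,
    conjRep_isIrreducible hS L, rfl⟩

variable [Fintype G] [Fintype H] {e : G → ℂ}

theorem finiteDimensional_indV {W : Type*} [AddCommGroup W] [Module ℂ W] [FiniteDimensional ℂ W]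
    (Y : Representation ℂ H W) : FiniteDimensional ℂ (IndV H.subtype Y) :=
  Module.Finite.of_surjective (indOfFun Y) fun v => ⟨funOfInd Y v, indOfFun_funOfInd Y v⟩

theorem finrank_indV_pos {W : Type*} [AddCommGroup W] [Module ℂ W] [FiniteDimensional ℂ W]
    [Nontrivial W] (Y : Representation ℂ H W) : 0 < Module.finrank ℂ (IndV H.subtype Y) := by
  have h := finrank_indV Y
  have h1 : (Module.finrank ℂ (IndV H.subtype Y) : ℂ) ≠ 0 := by
    rw [h]
    have : Module.finrank ℂ W ≠ 0 := Module.finrank_pos.ne'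
    simp [this]
  exact Nat.pos_of_ne_zero (by exact_mod_cast h1)

theorem sharedFraction_eq (he : IsProjectionKernel (coeffSpace (tensorPowerRep π t)) e)
    {W : Type*} [AddCommGroup W] [Module ℂ W] [FiniteDimensional ℂ W] [Nontrivial W]
    {Y : Representation ℂ H W} {c : ℂ} (hc : ∀ w, kernelAction (fun h : H => e h) Y w = c • w) :
    (sharedFraction π t Y : ℂ) = c := by
  have := finiteDimensional_indV Y
  have h0 : (Module.finrank ℂ (IndV H.subtype Y) : ℂ) ≠ 0 := by
    exact_mod_cast (finrank_indV_pos Y).ne'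
  rw [sharedFraction, Complex.ofReal_div, Complex.ofReal_natCast, Complex.ofReal_natCast,
    finrank_sharedPart he, trace_kernelAction_ind Y he.conj_inv hc, div_eq_iff h0, finrank_indV Y]
  ring

theorem kernelAction_eq_sharedFraction
    (he : IsProjectionKernel (coeffSpace (tensorPowerRep π t)) e)
    {W : Type*} [AddCommGroup W] [Module ℂ W] {Y : Representation ℂ H W} (hY : Y.IsIrreducible)
    (w : W) : kernelAction (fun h : H => e h) Y w = (sharedFraction π t Y : ℂ) • w := by
  have := finiteDimensional_of_isIrreducible hY
  have := nontrivial_of_isIrreducible hY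
  obtain ⟨c, hc⟩ := exists_kernelAction_eq_smul (e := fun h : H => e h)
    (fun g h => by simpa using he.conj_inv g h) hY
  rw [sharedFraction_eq π he hc, hc]

theorem sharedFraction_le_one {W : Type*} [AddCommGroup W] [Module ℂ W] [FiniteDimensional ℂ W]
    (Y : Representation ℂ H W) : sharedFraction π t Y ≤ 1 := by
  have := finiteDimensional_indV Y
  refine div_le_one_of_le₀ ?_ (by positivity)
  exact_mod_cast Submodule.finrank_le _

theorem sharedFraction_eq_one_iff (he : IsProjectionKernel (coeffSpace (tensorPowerRep π t)) e)
    {W : Type*} [AddCommGroup W] [Module ℂ W] [FiniteDimensional ℂ W] [Nontrivial W]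
    (Y : Representation ℂ H W) :
    sharedFraction π t Y = 1 ↔ IrrepsSubset (ind H.subtype Y) (tensorPowerRep π t) := by
  have := finiteDimensional_indV Y
  have h0 : (Module.finrank ℂ (IndV H.subtype Y) : ℝ) ≠ 0 := by
    exact_mod_cast (finrank_indV_pos Y).ne'
  rw [sharedFraction, div_eq_one_iff_eq h0, irrepsSubset_iff he, sharedPart_eq_range he,
    Nat.cast_inj]
  constructor
  · intro h v
    have h1 : v ∈ LinearMap.range (kernelAction e (ind H.subtype Y)) := by
      rw [Submodule.eq_top_of_finrank_eq h]; trivial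
    obtain ⟨w, rfl⟩ := h1
    exact he.kernelAction_idem _ _
  · intro h
    rw [show kernelAction e (ind H.subtype Y) = LinearMap.id from LinearMap.ext h,
      LinearMap.range_id, finrank_top]

variable (H t)

/-- Only boundedness of the dimensions is needed: finitely many quotients are possible, so the
supremum is attained. -/
theorem sharedFractions_finite : (sharedFractions π H t).Finite := by
  let N := Fintype.card G * Fintype.card H
  refine Set.Finite.subset (((Set.finite_Iic N).prod (Set.finite_Iic N)).image
    fun x : ℕ × ℕ => (x.1 / x.2 : ℝ)) ?_
  rintro r ⟨W, _, _, Y, hY, rfl⟩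
  have := finiteDimensional_of_isIrreducible hY
  have := finiteDimensional_indV Y
  have h1 : Module.finrank ℂ (IndV H.subtype Y) ≤ N := by
    refine (LinearMap.finrank_le_finrank_of_injective (f := funOfInd Y)
      (Function.LeftInverse.injective (indOfFun_funOfInd Y))).trans ?_
    rw [Module.finrank_pi_fintype]
    simp only [Finset.sum_const, Finset.card_univ, smul_eq_mul]
    exact Nat.mul_le_mul le_rfl (finrank_le_card_of_isIrreducible hY)
  exact ⟨(_, _), ⟨(Submodule.finrank_le _).trans h1, h1⟩, rfl⟩

theorem isGreatest_maxSharedFraction :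
    IsGreatest (sharedFractions π H t) (maxSharedFraction π H t) :=
  ⟨(sharedFractions_nonempty H π t).csSup_mem (sharedFractions_finite H π t),
    fun _ hr => le_csSup (sharedFractions_finite H π t).bddAbove hr⟩

theorem maxSharedFraction_nonneg : 0 ≤ maxSharedFraction π H t := by
  obtain ⟨W, _, _, Y, -, h⟩ := (isGreatest_maxSharedFraction H π t).1
  rw [h]
  exact sharedFraction_nonneg π Y

theorem maxSharedFraction_le_one : maxSharedFraction π H t ≤ 1 := by
  obtain ⟨W, _, _, Y, hY, h⟩ := (isGreatest_maxSharedFraction H π t).1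
  have := finiteDimensional_of_isIrreducible hY
  rw [h]
  exact sharedFraction_le_one π Y

variable {H t}

theorem existsCoveredIrrep_iff (he : IsProjectionKernel (coeffSpace (tensorPowerRep π t)) e) :
    ExistsCoveredIrrep π H t ↔ maxSharedFraction π H t = 1 := by
  constructor
  · rintro ⟨W, _, _, Y, hY, h⟩
    have := finiteDimensional_of_isIrreducible hY
    have := nontrivial_of_isIrreducible hY
    exact le_antisymm (maxSharedFraction_le_one H π t) <| (isGreatest_maxSharedFraction H π t).2
      ⟨W, _, _, Y, hY, ((sharedFraction_eq_one_iff π he Y).2 h).symm⟩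
  · intro h
    obtain ⟨W, _, _, Y, hY, h'⟩ := (isGreatest_maxSharedFraction H π t).1
    have := finiteDimensional_of_isIrreducible hY
    have := nontrivial_of_isIrreducible hY
    exact ⟨W, _, _, Y, hY, (sharedFraction_eq_one_iff π he Y).1 (h' ▸ h)⟩

theorem sum_subgroup_le_maxSharedFraction {φ : G → ℂ}
    (hφ : φ ∈ coeffSpace (tensorPowerRep π t)) :
    ∑ h : H, ‖φ h‖ ^ 2 ≤ maxSharedFraction π H t * ∑ g, ‖φ g‖ ^ 2 := by
  obtain ⟨e, he⟩ := (isBiInvariant_coeffSpace (tensorPowerRep π t)).exists_isProjectionKernel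
  refine sum_subgroup_le he (maxSharedFraction_nonneg H π t) (fun n Y c hY hc => ?_) hφ
  have := nontrivial_of_isIrreducible hY
  refine (isGreatest_maxSharedFraction H π t).2 ⟨_, _, _, Y, hY, ?_⟩
  exact_mod_cast (sharedFraction_eq π he hc).symm

/-- Positivity is what allows the extremal function to be normalised. -/
theorem maxSharedFraction_pos {φ : G → ℂ} (hφ : φ ∈ coeffSpace (tensorPowerRep π t))
    (h1 : φ 1 ≠ 0) : 0 < maxSharedFraction π H t := by
  refine (maxSharedFraction_nonneg H π t).lt_of_ne fun h => ?_
  have h2 := sum_subgroup_le_maxSharedFraction (H := H) π hφ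
  rw [← h, zero_mul] at h2
  have h3 : 0 < ∑ h : H, ‖φ h‖ ^ 2 := Finset.sum_pos' (fun _ _ => by positivity)
    ⟨1, Finset.mem_univ _, pow_pos (norm_pos_iff.2 (by simpa using h1)) 2⟩
  linarith

theorem exists_sum_subgroup_eq_maxSharedFraction (hpos : 0 < maxSharedFraction π H t) :
    ∃ φ ∈ coeffSpace (tensorPowerRep π t), ∑ g, ‖φ g‖ ^ 2 = 1 ∧
      ∑ h : H, ‖φ h‖ ^ 2 = maxSharedFraction π H t := by
  have hM := isBiInvariant_coeffSpace (tensorPowerRep π t)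
  obtain ⟨e, he⟩ := hM.exists_isProjectionKernel
  obtain ⟨W, _, _, Y, hY, h'⟩ := (isGreatest_maxSharedFraction H π t).1
  have := nontrivial_of_isIrreducible hY
  refine exists_sum_subgroup_eq hM he hpos (Y := Y) fun w => ?_
  rw [kernelAction_eq_sharedFraction π he hY, h']

end SharedFraction

/-! ### Output amplitudes are matrix coefficients of the tensor power -/

section Coefficients

variable {G : Type*} [Group G] {V : Type*} [NormedAddCommGroup V] [InnerProductSpace ℂ V]
  {ι : Type*} [Fintype ι] (b : OrthonormalBasis ι ℂ V) (π : G →* (V ≃ₗᵢ[ℂ] V))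

/-- The matrix of `π a` in the orthonormal basis `b`. -/
noncomputable def queryCoeff (a : G) (i j : ι) : ℂ := inner ℂ (b i) (π a (b j))

theorem map_basis_eq_sum (a : G) (j : ι) : π a (b j) = ∑ i, queryCoeff b π a i j • b i :=
  (b.sum_repr' _).symm

theorem queryCoeff_mul (a a' : G) (i j : ι) :
    queryCoeff b π (a * a') i j = ∑ k, queryCoeff b π a i k * queryCoeff b π a' k j := by
  have h1 : π (a * a') (b j) = π a (π a' (b j)) := by rw [map_mul]; rfl
  rw [queryCoeff, h1, map_basis_eq_sum b π a' j, map_sum, inner_sum]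
  refine Finset.sum_congr rfl fun k _ => ?_
  rw [map_smul, inner_smul_right, mul_comm]
  rfl

theorem queryCoeff_one [DecidableEq ι] (i j : ι) :
    queryCoeff b π 1 i j = if i = j then 1 else 0 := by
  simp [queryCoeff, orthonormal_iff_ite.1 b.orthonormal]

theorem queryCoeff_inv (a : G) (i j : ι) :
    queryCoeff b π a⁻¹ i j = starRingEnd ℂ (queryCoeff b π a j i) := by
  have h1 : π a (π a⁻¹ (b j)) = b j := by
    have h2 : (π a * π a⁻¹) (b j) = b j := by rw [← map_mul, mul_inv_cancel, map_one]; rfl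
    exact h2
  rw [queryCoeff, queryCoeff, inner_conj_symm, ← (π a).inner_map_map, h1]

/-- The matrix coefficients of `π^{⊗t}` in the product basis. -/
noncomputable def prodCoeff {t : ℕ} (p q : Fin t → ι) (a : G) : ℂ :=
  ∏ i, queryCoeff b π a (p i) (q i)

/-- The span of the matrix coefficients of `π^{⊗t}` in the product basis. -/
noncomputable def prodCoeffSpan (t : ℕ) : Submodule ℂ (G → ℂ) :=
  Submodule.span ℂ (Set.range fun x : (Fin t → ι) × (Fin t → ι) => prodCoeff b π x.1 x.2)

theorem tensorPowerRep_basis [DecidableEq ι] {t : ℕ} (q : Fin t → ι) (a : G) :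
    tensorPowerRep π t a (Basis.piTensorProduct (fun _ : Fin t => b.toBasis) q) =
      ∑ p : Fin t → ι, prodCoeff b π p q a • Basis.piTensorProduct (fun _ => b.toBasis) p := by
  rw [← (Basis.piTensorProduct (fun _ : Fin t => b.toBasis)).sum_repr
    (tensorPowerRep π t a _)]
  refine Finset.sum_congr rfl fun p _ => ?_
  congr 1
  have h1 : tensorPowerRep π t a (Basis.piTensorProduct (fun _ : Fin t => b.toBasis) q) =
      PiTensorProduct.tprod ℂ fun i => π a (b (q i)) := by
    rw [Basis.piTensorProduct_apply]
    simp [tensorPowerRep, PiTensorProduct.map_tprod]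
  rw [h1, Basis.piTensorProduct_repr_tprod_apply]
  simp [prodCoeff, queryCoeff, OrthonormalBasis.repr_apply_apply]

theorem coeffSpace_tensorPowerRep (t : ℕ) :
    coeffSpace (tensorPowerRep π t) = prodCoeffSpan b π t := by
  classical
  let B := Basis.piTensorProduct (fun _ : Fin t => b.toBasis)
  apply le_antisymm
  · refine Submodule.span_le.2 ?_
    rintro _ ⟨⟨l, v⟩, rfl⟩
    have h1 : (fun g => l (tensorPowerRep π t g v)) =
        ∑ q, ∑ p, (B.repr v q * l (B p)) • prodCoeff b π p q := by
      funext g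
      conv_lhs => rw [← B.sum_repr v]
      simp only [map_sum, map_smul, B, tensorPowerRep_basis, Finset.sum_apply, Pi.smul_apply,
        smul_eq_mul, Finset.mul_sum]
      refine Finset.sum_congr rfl fun q _ => Finset.sum_congr rfl fun p _ => by ring
    simp only [SetLike.mem_coe, h1]
    exact Submodule.sum_mem _ fun q _ => Submodule.sum_mem _ fun p _ =>
      Submodule.smul_mem _ _ (Submodule.subset_span ⟨(p, q), rfl⟩)
  · refine Submodule.span_le.2 ?_
    rintro _ ⟨⟨p, q⟩, rfl⟩
    have h1 : prodCoeff b π p q = fun g => B.coord p (tensorPowerRep π t g (B q)) := by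
      funext g
      simp only [B, tensorPowerRep_basis, map_sum, map_smul, Module.Basis.coord_apply,
        Module.Basis.repr_self]
      simp [Finsupp.single_apply]
    simp only [SetLike.mem_coe, h1]
    exact coeff_mem_coeffSpace _ _ _

theorem queryCoeff_mul_mem {t : ℕ} {φ : G → ℂ} (hφ : φ ∈ prodCoeffSpan b π t) (i j : ι) :
    (fun a => queryCoeff b π a i j * φ a) ∈ prodCoeffSpan b π (t + 1) := by
  induction hφ using Submodule.span_induction with
  | mem φ h =>
    obtain ⟨⟨p, q⟩, rfl⟩ := h
    refine Submodule.subset_span ⟨(Fin.snoc p i, Fin.snoc q j), ?_⟩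
    funext a
    simp [prodCoeff, Fin.prod_univ_castSucc, mul_comm]
  | zero =>
    simp only [Pi.zero_apply, mul_zero]
    exact Submodule.zero_mem _
  | add φ ψ _ _ h1 h2 =>
    simp only [Pi.add_apply, mul_add]
    exact Submodule.add_mem _ h1 h2
  | smul c φ _ h =>
    simp only [Pi.smul_apply, smul_eq_mul, mul_left_comm _ c]
    exact Submodule.smul_mem _ c h

theorem rTensor_eq_sum {E : Type*} [NormedAddCommGroup E] [InnerProductSpace ℂ E] (a : G)
    (v : V ⊗[ℂ] E) : (π a).rTensor E v = ∑ i, ∑ j, queryCoeff b π a i j •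
      LinearMap.rTensor E ((innerSL ℂ (b j)).toLinearMap.smulRight (b i)) v := by
  rw [LinearIsometryEquiv.rTensor_apply]
  have h1 : ((π a).toLinearEquiv : V →ₗ[ℂ] V) = ∑ i, ∑ j, queryCoeff b π a i j •
      (innerSL ℂ (b j)).toLinearMap.smulRight (b i) := by
    refine b.toBasis.ext fun k => ?_
    classical
    simp [LinearMap.sum_apply, orthonormal_iff_ite.1 b.orthonormal, map_basis_eq_sum]
  change LinearMap.rTensorHom E ((π a).toLinearEquiv : V →ₗ[ℂ] V) v = _
  rw [h1]
  simp [map_sum, LinearMap.sum_apply]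

/-- Each query contributes one factor, a matrix entry of π(a). Everything independent of a,
including the unitary, is absorbed into the functional, hence the induction over all `l`. Adaptivity
thus gives no new amplitudes. -/
theorem foldl_mem_prodCoeffSpan {E : Type*} [NormedAddCommGroup E] [InnerProductSpace ℂ E]
    {t : ℕ} (ψ : V ⊗[ℂ] E) (U : Fin t → (V ⊗[ℂ] E ≃ₗᵢ[ℂ] V ⊗[ℂ] E)) (l : V ⊗[ℂ] E →ₗ[ℂ] ℂ) :
    (fun a => l (Fin.foldl t (fun φ i => U i ((π a).rTensor E φ)) ψ)) ∈ prodCoeffSpan b π t := by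
  induction t generalizing l with
  | zero =>
    have h1 : (fun a : G => l (Fin.foldl 0 (fun φ i => U i ((π a).rTensor E φ)) ψ)) =
        l ψ • prodCoeff b π (Fin.elim0 : Fin 0 → ι) Fin.elim0 := by
      funext a
      simp [prodCoeff]
    rw [h1]
    exact Submodule.smul_mem _ _ (Submodule.subset_span ⟨(_, _), rfl⟩)
  | succ t ih =>
    have h1 : (fun a : G => l (Fin.foldl (t + 1) (fun φ i => U i ((π a).rTensor E φ)) ψ)) =
        ∑ i, ∑ j, fun a => queryCoeff b π a i j *
          (l ∘ₗ (U (Fin.last t)).toLinearEquiv.toLinearMap ∘ₗ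
            LinearMap.rTensor E ((innerSL ℂ (b j)).toLinearMap.smulRight (b i)))
          (Fin.foldl t (fun φ i => U i.castSucc ((π a).rTensor E φ)) ψ) := by
      funext a
      rw [Fin.foldl_succ_last, rTensor_eq_sum b]
      simp [map_sum, map_smul, Finset.sum_apply]
    rw [h1]
    exact Submodule.sum_mem _ fun i _ => Submodule.sum_mem _ fun j _ =>
      queryCoeff_mul_mem b π (ih _ _) i j

end Coefficients

/-! ### Upper bound on the success probability -/

section UpperBound

theorem sum_re_inner_eq_one {E X : Type*} [NormedAddCommGroup E] [InnerProductSpace ℂ E]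
    [Fintype X] {T : X → E →ₗ[ℂ] E} (hT : ∑ x, T x = LinearMap.id) {v : E} (hv : ‖v‖ = 1) :
    ∑ x, (inner ℂ v (T x v)).re = 1 := by
  rw [← Complex.re_sum, ← inner_sum, ← LinearMap.sum_apply, hT, LinearMap.id_apply,
    inner_self_eq_norm_sq_to_K, hv]
  simp

variable {G V X : Type*} [Group G] [NormedAddCommGroup V] [InnerProductSpace ℂ V]
  [Fintype X] (π : G →* (V ≃ₗᵢ[ℂ] V))

theorem norm_foldl {E : Type*} [NormedAddCommGroup E] [InnerProductSpace ℂ E] {t : ℕ}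
    (ψ : V ⊗[ℂ] E) (U : Fin t → (V ⊗[ℂ] E ≃ₗᵢ[ℂ] V ⊗[ℂ] E)) (a : G) :
    ‖Fin.foldl t (fun φ i => U i ((π a).rTensor E φ)) ψ‖ = ‖ψ‖ := by
  induction t with
  | zero => simp
  | succ t ih =>
    rw [Fin.foldl_succ_last, LinearIsometryEquiv.norm_map, LinearIsometryEquiv.norm_map]
    exact ih _

theorem QueryAlgorithm.norm_output {t : ℕ} (A : QueryAlgorithm V X t) (a : G) :
    ‖A.output π a‖ = 1 :=
  (norm_foldl π A.input A.U a).trans A.norm_input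

variable [FiniteDimensional ℂ V]

theorem QueryAlgorithm.apply_output_mem {t : ℕ} (A : QueryAlgorithm V X t)
    (l : Register V A.N →ₗ[ℂ] ℂ) :
    (fun a => l (A.output π a)) ∈ coeffSpace (tensorPowerRep π t) := by
  rw [coeffSpace_tensorPowerRep (stdOrthonormalBasis ℂ V)]
  exact foldl_mem_prodCoeffSpan _ π _ _ l

variable [Fintype G] [DecidableEq X]

theorem QueryAlgorithm.successProb_le {t : ℕ} (A : QueryAlgorithm V X t) (f : G → X) {d : ℝ}
    (hd : ∀ x, ∀ φ ∈ coeffSpace (tensorPowerRep π t),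
      ∑ a with f a = x, ‖φ a‖ ^ 2 ≤ d * ∑ a, ‖φ a‖ ^ 2) : A.successProb π f ≤ d := by
  have h1 : ∀ x, ∑ a with f a = x, A.outcomeProb π a x ≤ d * ∑ a, A.outcomeProb π a x := by
    intro x
    have hT := (A.E_pos x).isSymmetric
    -- Diagonalising the effect writes the outcome probability as a nonnegative combination of
    -- squared amplitudes, each the square modulus of a function in the coefficient space.
    have hx : ∀ a, A.outcomeProb π a x = ∑ i, hT.eigenvalues rfl i *
        ‖inner ℂ (hT.eigenvectorBasis rfl i) (A.output π a)‖ ^ 2 := fun a =>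
      hT.re_inner_eq_sum rfl _
    simp only [hx]
    rw [Finset.sum_comm, Finset.sum_comm (s := Finset.univ (α := G)), Finset.mul_sum]
    refine Finset.sum_le_sum fun i _ => ?_
    rw [← Finset.mul_sum, ← Finset.mul_sum, mul_left_comm]
    refine mul_le_mul_of_nonneg_left ?_ ((A.E_pos x).nonneg_eigenvalues rfl i)
    exact hd x _ (A.apply_output_mem π (innerSL ℂ (hT.eigenvectorBasis rfl i)).toLinearMap)
  have h2 : ∑ a, A.outcomeProb π a (f a) ≤ d * Fintype.card G := by
    rw [← Finset.sum_fiberwise Finset.univ f]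
    calc ∑ x, ∑ a with f a = x, A.outcomeProb π a (f a)
        = ∑ x, ∑ a with f a = x, A.outcomeProb π a x :=
          Finset.sum_congr rfl fun x _ => Finset.sum_congr rfl fun a ha => by
            rw [(Finset.mem_filter.1 ha).2]
      _ ≤ ∑ x, d * ∑ a, A.outcomeProb π a x := Finset.sum_le_sum fun x _ => h1 x
      _ = d * ∑ a, ∑ x, A.outcomeProb π a x := by rw [← Finset.mul_sum, Finset.sum_comm]
      _ = d * Fintype.card G := by
        congr 1
        have h3 : ∀ a, ∑ x, A.outcomeProb π a x = 1 := fun a =>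
          sum_re_inner_eq_one A.E_sum (A.norm_output π a)
        simp [h3]
  rw [successProb, one_div, inv_mul_le_iff₀ (by exact_mod_cast Fintype.card_pos), mul_comm]
  exact h2

end UpperBound

/-! ### Realising vectors through unitary intertwiners and measurements through contractions -/

section HilbertSpace

variable {G Z E : Type*} [NormedAddCommGroup Z] [InnerProductSpace ℂ Z]
  [NormedAddCommGroup E] [InnerProductSpace ℂ E]

/-- Families of vectors with the same Gram matrix are related by a contraction. -/
theorem exists_contraction_of_gram [Fintype G] {u : G → Z} {w : G → E}
    (h : ∀ a b, inner ℂ (u a) (u b) = inner ℂ (w a) (w b)) :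
    ∃ W : Z →ₗ[ℂ] E, (∀ a, W (u a) = w a) ∧ ∀ v, ‖W v‖ ≤ ‖v‖ := by
  let cu : (G → ℂ) →ₗ[ℂ] Z := Fintype.linearCombination ℂ u
  let cw : (G → ℂ) →ₗ[ℂ] E := Fintype.linearCombination ℂ w
  have hnorm : ∀ x, ‖cw x‖ = ‖cu x‖ := fun x => by
    have h1 : inner ℂ (cu x) (cu x) = inner ℂ (cw x) (cw x) := by
      simp only [cu, cw, Fintype.linearCombination_apply, sum_inner, inner_sum, inner_smul_left,
        inner_smul_right, h]
    rw [inner_self_eq_norm_sq_to_K, inner_self_eq_norm_sq_to_K] at h1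
    have h2 : ‖cu x‖ ^ 2 = ‖cw x‖ ^ 2 := by exact_mod_cast h1
    exact ((sq_eq_sq₀ (norm_nonneg _) (norm_nonneg _)).1 h2).symm
  -- The choice of section is immaterial: by `hnorm`, `cw` vanishes on the kernel of `cu`.
  obtain ⟨s, hs⟩ := LinearMap.exists_rightInverse_of_surjective cu.rangeRestrict
    cu.range_rangeRestrict
  have hs' : ∀ v, cu (s v) = v := fun v => congrArg Subtype.val (LinearMap.congr_fun hs v)
  let p := (LinearMap.range cu).orthogonalProjectionOnto
  refine ⟨cw ∘ₗ s ∘ₗ p.toLinearMap, fun a => ?_, fun v => ?_⟩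
  · classical
    have hu : cu (Pi.single a 1) = u a := by
      simp [cu, Fintype.linearCombination_apply_single]
    have hw : cw (Pi.single a 1) = w a := by
      simp [cw, Fintype.linearCombination_apply_single]
    have hp : p (u a) = ⟨u a, ⟨_, hu⟩⟩ :=
      Submodule.orthogonalProjectionOnto_mem_subspace_eq_self (K := LinearMap.range cu)
        ⟨u a, ⟨_, hu⟩⟩
    have h1 : cw (s (p (u a)) - Pi.single a 1) = 0 := by
      rw [← norm_eq_zero, hnorm, map_sub, hs', hp, hu, sub_self, norm_zero]
    rw [map_sub, sub_eq_zero, hw] at h1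
    exact h1
  · change ‖cw (s (p v))‖ ≤ ‖v‖
    rw [hnorm, hs']
    exact Submodule.norm_orthogonalProjectionOnto_apply_le _ v

variable [FiniteDimensional ℂ Z] [FiniteDimensional ℂ E]

open LinearMap in
theorem range_comp_adjoint_self (T : Z →ₗ[ℂ] E) :
    LinearMap.range (T ∘ₗ adjoint T) = LinearMap.range T := by
  have h1 : (LinearMap.range (T ∘ₗ adjoint T))ᗮ = (LinearMap.range T)ᗮ := by
    rw [LinearMap.orthogonal_range, LinearMap.orthogonal_range, LinearMap.adjoint_comp,
      LinearMap.adjoint_adjoint, LinearMap.ker_self_comp_adjoint]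
  rw [← Submodule.orthogonal_orthogonal (LinearMap.range T), ← h1,
    Submodule.orthogonal_orthogonal]

/-- A positive operator has a symmetric square root commuting with its commutant. -/
theorem exists_symmetric_sqrt {S : E →ₗ[ℂ] E} (hS : S.IsPositive) :
    ∃ Q : E →ₗ[ℂ] E, Q.IsSymmetric ∧ (∀ v, Q (Q v) = S v) ∧
      ∀ R : E →ₗ[ℂ] E, (∀ v, S (R v) = R (S v)) → ∀ v, Q (R v) = R (Q v) := by
  let S' : E →L[ℂ] E := LinearMap.toContinuousLinearMap S
  have hS' : 0 ≤ S' := by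
    rw [ContinuousLinearMap.nonneg_iff_isPositive]
    exact LinearMap.isPositive_toContinuousLinearMap_iff S |>.2 hS
  let Q : E →L[ℂ] E := CFC.sqrt S'
  refine ⟨Q, ?_, fun v => ?_, fun R hR v => ?_⟩
  · exact ((ContinuousLinearMap.nonneg_iff_isPositive Q).1 (CFC.sqrt_nonneg S')).isSymmetric
  · exact congrArg (fun A : E →L[ℂ] E => A v) (CFC.sqrt_mul_sqrt_self S' hS')
  · have h1 : Commute S' (LinearMap.toContinuousLinearMap R) := by
      ext w
      exact hR w
    have h2 : Commute Q (LinearMap.toContinuousLinearMap R) := h1.cfcₙ_nnreal _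
    exact congrArg (fun A : E →L[ℂ] E => A v) h2.eq

/-- A vector in the range of an intertwiner of unitary representations generates the same
positive definite function as some vector in the source. -/
theorem exists_inner_eq_of_mem_range [Group G] {ρ : Representation ℂ G Z}
    {R : Representation ℂ G E}
    (hρ : ∀ g x y, inner ℂ x (ρ g y) = inner ℂ (ρ g⁻¹ x) y)
    (hR : ∀ g x y, inner ℂ x (R g y) = inner ℂ (R g⁻¹ x) y)
    {T : Z →ₗ[ℂ] E} (hT : ∀ g x, T (ρ g x) = R g (T x)) {φ : E} (hφ : φ ∈ LinearMap.range T) :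
    ∃ ψ : Z, ∀ a b, inner ℂ (ρ a ψ) (ρ b ψ) = inner ℂ (R a φ) (R b φ) := by
  have hT' : ∀ g y, LinearMap.adjoint T (R g y) = ρ g (LinearMap.adjoint T y) := fun g y => by
    refine ext_inner_left ℂ fun x => ?_
    rw [LinearMap.adjoint_inner_right, hR, hρ, ← hT, LinearMap.adjoint_inner_right]
  have hS : (T ∘ₗ LinearMap.adjoint T).IsPositive := by
    simpa using LinearMap.isPositive_adjoint_comp_self (LinearMap.adjoint T)
  obtain ⟨Q, hQ, hQQ, hQR⟩ := exists_symmetric_sqrt hS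
  rw [← range_comp_adjoint_self] at hφ
  -- With φ = TT*χ and Q² = TT*, the vector ψ = T*Qχ works: ⟨ψ, ρ(g)ψ⟩ = ⟨Qχ, Q²R(g)Qχ⟩ = ⟨Q²χ,
  -- R(g)Q²χ⟩, because Q commutes with R(g).
  obtain ⟨χ, rfl⟩ := hφ
  have hQR' := fun g => hQR (R g) fun v => by
    simp only [LinearMap.comp_apply, hT', hT]
  have h1 : ∀ g, inner ℂ (LinearMap.adjoint T (Q χ)) (ρ g (LinearMap.adjoint T (Q χ))) =
      inner ℂ ((T ∘ₗ LinearMap.adjoint T) χ) (R g ((T ∘ₗ LinearMap.adjoint T) χ)) := fun g => by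
    rw [← hT', LinearMap.adjoint_inner_left]
    have h2 : T (LinearMap.adjoint T (R g (Q χ))) = Q (Q (R g (Q χ))) := by rw [hQQ]; rfl
    rw [h2, ← hQ, hQR', hQQ]
  refine ⟨LinearMap.adjoint T (Q χ), fun a b => ?_⟩
  have h4 := h1 (a⁻¹ * b)
  rw [map_mul, map_mul, Module.End.mul_apply, Module.End.mul_apply, hρ, hR, inv_inv] at h4
  exact h4

/-- A contraction into `L²(G)` and a labelling of `G` define a POVM. -/
theorem exists_povm_of_contraction {X : Type*} [Fintype X] [DecidableEq X] [Fintype G]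
    (W : Z →ₗ[ℂ] EuclideanSpace ℂ G) (hW : ∀ v, ‖W v‖ ≤ ‖v‖) (p : G → X) (x₁ : X) :
    ∃ P : X → (Z →ₗ[ℂ] Z), (∀ x, (P x).IsPositive) ∧ ∑ x, P x = LinearMap.id ∧
      ∀ x v, ‖W v‖ = ‖v‖ → (inner ℂ v (P x v)).re = ∑ k with p k = x, ‖W v k‖ ^ 2 := by
  let D : X → EuclideanSpace ℂ G →ₗ[ℂ] EuclideanSpace ℂ G := fun x =>
    (WithLp.linearEquiv 2 ℂ (G → ℂ)).symm.toLinearMap ∘ₗ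
      LinearMap.pi (fun k => if p k = x then LinearMap.proj k else 0) ∘ₗ
        (WithLp.linearEquiv 2 ℂ (G → ℂ)).toLinearMap
  have hD : ∀ x φ k, D x φ k = if p k = x then φ k else 0 := fun x φ k => by
    by_cases h : p k = x <;> simp [D, h]
  let C : Z →ₗ[ℂ] Z := LinearMap.id - LinearMap.adjoint W ∘ₗ W
  have hinner : ∀ v, (inner ℂ v (C v)).re = ‖v‖ ^ 2 - ‖W v‖ ^ 2 := fun v => by
    simp only [C, LinearMap.sub_apply, LinearMap.id_apply, LinearMap.comp_apply, inner_sub_right,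
      LinearMap.adjoint_inner_right, inner_self_eq_norm_sq_to_K]
    norm_cast
  have hC : C.IsPositive := by
    refine ⟨LinearMap.IsSymmetric.id.sub (LinearMap.isPositive_adjoint_comp_self W).isSymmetric,
      fun v => ?_⟩
    have h1 := hinner v
    have h2 : (inner ℂ (C v) v).re = (inner ℂ v (C v)).re := inner_re_symm (𝕜 := ℂ) _ _
    change 0 ≤ (inner ℂ (C v) v).re
    rw [h2, h1, sub_nonneg]
    exact pow_le_pow_left₀ (norm_nonneg _) (hW v) 2
  -- The defect 1 − W*W completes the effects to the identity. It is put on the arbitrary label x₁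
  -- and vanishes in expectation wherever W preserves the norm.
  let P : X → (Z →ₗ[ℂ] Z) := fun x =>
    LinearMap.adjoint (D x ∘ₗ W) ∘ₗ (D x ∘ₗ W) + if x = x₁ then C else 0
  refine ⟨P, fun x => ?_, ?_, fun x v hv => ?_⟩
  · refine (LinearMap.isPositive_adjoint_comp_self _).add ?_
    split_ifs
    · exact hC
    · exact LinearMap.isPositive_zero
  · refine LinearMap.ext fun v => ext_inner_left ℂ fun v' => ?_
    have h1 : ∑ x, inner ℂ (D x (W v')) (D x (W v)) = inner ℂ (W v') (W v) := by
      simp only [PiLp.inner_apply, hD]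
      rw [Finset.sum_comm]
      refine Finset.sum_congr rfl fun k _ => ?_
      rw [Finset.sum_eq_single (p k)]
      · simp
      · intro x _ hx
        simp [hx.symm]
      · simp
    simp only [P, Finset.sum_add_distrib, Finset.sum_ite_eq', Finset.mem_univ, if_true,
      LinearMap.add_apply, LinearMap.sum_apply, inner_add_right, inner_sum, LinearMap.comp_apply]
    simp only [← LinearMap.comp_apply]
    simp only [LinearMap.comp_apply, h1, C, LinearMap.sub_apply, LinearMap.id_apply,
      inner_sub_right, LinearMap.adjoint_inner_right]
    ring
  · have h1 : (inner ℂ v ((if x = x₁ then C else 0) v)).re = 0 := by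
      split_ifs
      · rw [hinner, hv, sub_self]
      · simp
    simp only [P, LinearMap.add_apply, inner_add_right, Complex.add_re, h1, add_zero]
    rw [LinearMap.comp_apply, LinearMap.adjoint_inner_right, inner_self_eq_norm_sq_to_K]
    have h2 : ‖(D x ∘ₗ W) v‖ ^ 2 = ∑ k with p k = x, ‖W v k‖ ^ 2 := by
      rw [EuclideanSpace.norm_sq_eq, Finset.sum_filter]
      refine Finset.sum_congr rfl fun k _ => ?_
      rw [LinearMap.comp_apply, hD]
      split_ifs <;> simp
    rw [← h2]
    norm_cast

end HilbertSpace

/-! ### Simulating the tensor power by sequential queries -/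

section Simulation

variable {G V ι κ : Type*} [Group G] [NormedAddCommGroup V] [InnerProductSpace ℂ V]
  [Fintype ι] (b : OrthonormalBasis ι ℂ V) (π : G →* (V ≃ₗᵢ[ℂ] V))

/-- The family `χ` of states arises from a `t`-query circuit with workspace dimension `N`. -/
def IsReachable (π : G →* (V ≃ₗᵢ[ℂ] V)) (N t : ℕ) (χ : G → Register V N) : Prop :=
  ∃ (ψ : Register V N) (U : Fin t → (Register V N ≃ₗᵢ[ℂ] Register V N)), ∀ a,
    χ a = Fin.foldl t (fun φ i => U i ((π a).rTensor (EuclideanSpace ℂ (Fin N)) φ)) ψ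

theorem isReachable_zero {N : ℕ} (ψ : Register V N) : IsReachable π N 0 fun _ => ψ :=
  ⟨ψ, fun i => i.elim0, fun a => by simp⟩

theorem IsReachable.succ {N t : ℕ} {χ : G → Register V N} (h : IsReachable π N t χ)
    (U : Register V N ≃ₗᵢ[ℂ] Register V N) :
    IsReachable π N (t + 1) fun a => U ((π a).rTensor (EuclideanSpace ℂ (Fin N)) (χ a)) := by
  obtain ⟨ψ, W, hW⟩ := h
  refine ⟨ψ, Fin.snoc W U, fun a => ?_⟩
  rw [Fin.foldl_succ_last]
  simp [hW]

/-- The unitary identification of the register with a coordinate space. -/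
noncomputable def registerIso {N : ℕ} {μ : Type*} [Fintype μ] (ε : μ ≃ ι × Fin N) :
    EuclideanSpace ℂ μ ≃ₗᵢ[ℂ] Register V N :=
  (LinearIsometryEquiv.piLpCongrLeft 2 ℂ ℂ ε).trans
    (b.tensorProduct (EuclideanSpace.basisFun (Fin N) ℂ)).repr.symm

theorem registerIso_symm_apply {N : ℕ} {μ : Type*} [Fintype μ] (ε : μ ≃ ι × Fin N)
    (v : Register V N) (m : μ) : (registerIso b ε).symm v m =
      (b.tensorProduct (EuclideanSpace.basisFun (Fin N) ℂ)).repr v (ε m) := by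
  simp [registerIso, LinearIsometryEquiv.piLpCongrLeft_apply]

theorem repr_rTensor {N : ℕ} (a : G) (v : Register V N) (k : ι) (n : Fin N) :
    (b.tensorProduct (EuclideanSpace.basisFun (Fin N) ℂ)).repr
      ((π a).rTensor (EuclideanSpace ℂ (Fin N)) v) (k, n) =
    ∑ l, queryCoeff b π a k l *
      (b.tensorProduct (EuclideanSpace.basisFun (Fin N) ℂ)).repr v (l, n) := by
  induction v using TensorProduct.induction_on with
  | zero => simp
  | tmul x y =>
    rw [LinearIsometryEquiv.rTensor_apply]
    change (b.tensorProduct (EuclideanSpace.basisFun (Fin N) ℂ)).repr (π a x ⊗ₜ[ℂ] y) (k, n) = _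
    have h1 : b.repr (π a x) k = ∑ l, queryCoeff b π a k l * b.repr x l := by
      conv_lhs => rw [b.repr_apply_apply, ← b.sum_repr x, map_sum, inner_sum]
      refine Finset.sum_congr rfl fun l _ => ?_
      rw [map_smul, inner_smul_right, mul_comm]
      rfl
    simp only [OrthonormalBasis.tensorProduct_repr_tmul_apply, h1, Finset.mul_sum]
    refine Finset.sum_congr rfl fun l _ => by ring
  | add x y hx hy =>
    simp only [map_add, PiLp.add_apply, hx, hy, mul_add, Finset.sum_add_distrib]

/-- The operator acting by the matrices `B i` on the tensor factors. -/
noncomputable def slotOp {t : ℕ} (B : Fin t → ι → ι → ℂ) (x : EuclideanSpace ℂ ((Fin t → ι) × κ)) :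
    EuclideanSpace ℂ ((Fin t → ι) × κ) :=
  WithLp.toLp 2 fun m => ∑ q : Fin t → ι, (∏ i, B i (m.1 i) (q i)) * x (q, m.2)

theorem slotOp_apply {t : ℕ} (B : Fin t → ι → ι → ℂ) (x : EuclideanSpace ℂ ((Fin t → ι) × κ))
    (p : Fin t → ι) (r : κ) :
    slotOp B x (p, r) = ∑ q : Fin t → ι, (∏ i, B i (p i) (q i)) * x (q, r) := rfl

variable [DecidableEq ι]

/-- The matrices after `s` queries: the first `s` tensor factors have been queried. -/
noncomputable def partialCoeff (t s : ℕ) (a : G) (i : Fin t) (k l : ι) : ℂ :=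
  if (i : ℕ) < s then queryCoeff b π a k l else if k = l then 1 else 0

theorem slotOp_partialCoeff_zero (t : ℕ) (a : G) (x : EuclideanSpace ℂ ((Fin t → ι) × κ)) :
    slotOp (partialCoeff b π t 0 a) x = x := by
  ext ⟨p, r⟩
  rw [slotOp_apply, Finset.sum_eq_single p]
  · simp [partialCoeff]
  · intro q _ hq
    obtain ⟨i, hi⟩ := Function.ne_iff.1 hq
    rw [Finset.prod_eq_zero (Finset.mem_univ i), zero_mul]
    simp [partialCoeff, hi.symm]
  · simp

theorem slotOp_partialCoeff_succ {t : ℕ} (s : Fin t) (a : G)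
    (x : EuclideanSpace ℂ ((Fin t → ι) × κ)) (p : Fin t → ι) (r : κ) :
    slotOp (partialCoeff b π t (s + 1) a) x (p, r) =
      ∑ l, queryCoeff b π a (p s) l *
        slotOp (partialCoeff b π t s a) x (Function.update p s l, r) := by
  simp only [slotOp_apply, Finset.mul_sum]
  rw [Finset.sum_comm]
  refine Finset.sum_congr rfl fun q _ => ?_
  have h1 : ∀ l, ∏ i, partialCoeff b π t s a i (Function.update p s l i) (q i) =
      (if l = q s then 1 else 0) *
        ∏ i ∈ Finset.univ.erase s, partialCoeff b π t s a i (p i) (q i) := fun l => by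
    rw [← Finset.mul_prod_erase _ _ (Finset.mem_univ s)]
    congr 1
    · simp [partialCoeff]
    · refine Finset.prod_congr rfl fun i hi => ?_
      rw [Function.update_of_ne (Finset.ne_of_mem_erase hi)]
  have h2 : ∏ i, partialCoeff b π t (s + 1) a i (p i) (q i) = queryCoeff b π a (p s) (q s) *
      ∏ i ∈ Finset.univ.erase s, partialCoeff b π t s a i (p i) (q i) := by
    rw [← Finset.mul_prod_erase _ _ (Finset.mem_univ s)]
    congr 1
    · simp [partialCoeff]
    · refine Finset.prod_congr rfl fun i hi => ?_
      have h3 : (i : ℕ) ≠ s := fun h => Finset.ne_of_mem_erase hi (Fin.ext h)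
      have h4 : (i : ℕ) < s + 1 ↔ (i : ℕ) < s := by omega
      simp [partialCoeff, h4]
  simp only [h1, h2]
  rw [Finset.sum_eq_single (q s)]
  · simp [mul_assoc]
  · intro l _ hl
    simp [hl]
  · simp

variable [Fintype κ]

/-- The unitary after a query can rearrange all coordinates, so the identification σ is left free in
the induction. Before query s it is chosen so that tensor factor s occupies the query register; `hN`
keeps the workspace dimension constant. -/
theorem slotOp_partialCoeff_isReachable {N t : ℕ}
    (hN : ∀ s : Fin t, Fintype.card (({j // j ≠ s} → ι) × κ) = N)
    (x : EuclideanSpace ℂ ((Fin t → ι) × κ)) (s : ℕ) (hs : s ≤ t)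
    (σ : EuclideanSpace ℂ ((Fin t → ι) × κ) ≃ₗᵢ[ℂ] Register V N) :
    IsReachable π N s fun a => σ (slotOp (partialCoeff b π t s a) x) := by
  induction s generalizing σ with
  | zero =>
    simp only [slotOp_partialCoeff_zero]
    exact isReachable_zero π _
  | succ s ih =>
    let i : Fin t := ⟨s, hs⟩
    let ε : (Fin t → ι) × κ ≃ ι × Fin N :=
      ((Equiv.funSplitAt i ι).prodCongr (Equiv.refl κ)).trans <|
        (Equiv.prodAssoc _ _ _).trans <|
          (Equiv.refl ι).prodCongr (Fintype.equivFinOfCardEq (hN i))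
    have hε1 : ∀ p r, (ε (p, r)).1 = p i := fun p r => rfl
    have hε2 : ∀ p r l, ε (Function.update p i l, r) = (l, (ε (p, r)).2) := fun p r l => by
      refine Prod.ext ?_ ?_
      · rw [hε1]; simp
      · have h1 : (fun j : {j // j ≠ i} => Function.update p i l j) =
              fun j : {j // j ≠ i} => p j := by
          funext j
          exact Function.update_of_ne j.2 _ _
        change Fintype.equivFinOfCardEq (hN i)
          ((fun j : {j // j ≠ i} => Function.update p i l j), r) = _
        rw [h1]
        rfl
    let σ' := registerIso b ε
    have h1 := (ih (Nat.le_of_succ_le hs) σ').succ π (σ'.symm.trans σ)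
    convert h1 using 2 with a
    rw [LinearIsometryEquiv.trans_apply]
    congr 1
    ext ⟨p, r⟩
    rw [registerIso_symm_apply, show ε (p, r) = (p i, (ε (p, r)).2) from rfl, repr_rTensor,
      slotOp_partialCoeff_succ b π i]
    refine Finset.sum_congr rfl fun l _ => ?_
    rw [← hε2, ← registerIso_symm_apply, LinearIsometryEquiv.symm_apply_apply]

/-- The representation by `π^{⊗t}` on coordinates, with multiplicity space `ℂ^κ`. -/
noncomputable def prodRep (t : ℕ) (κ : Type*) [Fintype κ] :
    Representation ℂ G (EuclideanSpace ℂ ((Fin t → ι) × κ)) where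
  toFun a :=
    { toFun := slotOp fun _ => queryCoeff b π a
      map_add' := fun x y => by
        ext ⟨p, r⟩
        simp [slotOp_apply, mul_add, Finset.sum_add_distrib]
      map_smul' := fun c x => by
        ext ⟨p, r⟩
        simp [slotOp_apply, Finset.mul_sum, mul_left_comm] }
  map_one' := by
    refine LinearMap.ext fun x => ?_
    conv_rhs => rw [Module.End.one_apply, ← slotOp_partialCoeff_zero b π t 1 x]
    change slotOp _ x = _
    congr 1
    funext i k l
    simp [queryCoeff_one, partialCoeff]
  map_mul' a a' := by
    refine LinearMap.ext fun x => ?_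
    ext ⟨p, r⟩
    rw [Module.End.mul_apply]
    change slotOp _ x (p, r) = slotOp _ (slotOp _ x) (p, r)
    simp only [slotOp_apply, Finset.mul_sum]
    rw [Finset.sum_comm]
    refine Finset.sum_congr rfl fun q _ => ?_
    simp only [← mul_assoc, ← Finset.sum_mul, queryCoeff_mul, ← Finset.prod_mul_distrib]
    rw [Fintype.prod_sum]

theorem prodRep_apply (t : ℕ) (a : G) (x : EuclideanSpace ℂ ((Fin t → ι) × κ))
    (p : Fin t → ι) (r : κ) :
    prodRep b π t κ a x (p, r) = ∑ q, prodCoeff b π p q a * x (q, r) := rfl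

theorem prodRep_eq_slotOp (t : ℕ) (a : G) (x : EuclideanSpace ℂ ((Fin t → ι) × κ)) :
    prodRep b π t κ a x = slotOp (partialCoeff b π t t a) x := by
  ext ⟨p, r⟩
  rw [prodRep_apply, slotOp_apply]
  simp [prodCoeff, partialCoeff]

theorem inner_prodRep (t : ℕ) (a : G) (x y : EuclideanSpace ℂ ((Fin t → ι) × κ)) :
    inner ℂ x (prodRep b π t κ a y) = inner ℂ (prodRep b π t κ a⁻¹ x) y := by
  have h1 : ∀ p q : Fin t → ι, prodCoeff b π q p a⁻¹ = starRingEnd ℂ (prodCoeff b π p q a) := fun p q => by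
    simp [prodCoeff, queryCoeff_inv, map_prod]
  simp only [PiLp.inner_apply, RCLike.inner_apply, Fintype.sum_prod_type, prodRep_apply, map_sum,
    map_mul, h1, Complex.conj_conj, Finset.sum_mul, Finset.mul_sum]
  rw [Finset.sum_comm]
  conv_rhs => rw [Finset.sum_comm]
  refine Finset.sum_congr rfl fun r _ => ?_
  rw [Finset.sum_comm]
  refine Finset.sum_congr rfl fun q _ => Finset.sum_congr rfl fun p _ => by ring

/-- The intertwiner from the coordinate representation to functions on `G`. -/
noncomputable def coeffMap (t : ℕ) :
    EuclideanSpace ℂ ((Fin t → ι) × ((Fin t → ι) × ι)) →ₗ[ℂ] EuclideanSpace ℂ G where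
  toFun x := WithLp.toLp 2 fun g => ∑ r : (Fin t → ι) × ι, ∑ q, prodCoeff b π r.1 q g * x (q, r)
  map_add' x y := by
    ext g
    simp [mul_add, Finset.sum_add_distrib]
  map_smul' c x := by
    ext g
    simp [Finset.mul_sum, mul_left_comm]

theorem coeffMap_apply (t : ℕ) (x : EuclideanSpace ℂ ((Fin t → ι) × ((Fin t → ι) × ι))) (g : G) :
    coeffMap b π t x g = ∑ r : (Fin t → ι) × ι, prodRep b π t _ g x (r.1, r) := rfl

theorem coeffMap_prodRep (t : ℕ) (a : G)
    (x : EuclideanSpace ℂ ((Fin t → ι) × ((Fin t → ι) × ι))) :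
    coeffMap b π t (prodRep b π t _ a x) = rightRegular G a (coeffMap b π t x) := by
  ext g
  rw [rightRegular_apply, coeffMap_apply, coeffMap_apply]
  simp [map_mul]

theorem mem_range_coeffMap [Nonempty ι] {t : ℕ} {φ : G → ℂ} (hφ : φ ∈ prodCoeffSpan b π t) :
    WithLp.toLp 2 φ ∈ LinearMap.range (coeffMap b π t) := by
  have h1 : prodCoeffSpan b π t ≤ (LinearMap.range (coeffMap b π t)).comap
      (WithLp.linearEquiv 2 ℂ (G → ℂ)).symm.toLinearMap := by
    refine Submodule.span_le.2 ?_
    rintro _ ⟨⟨p, q⟩, rfl⟩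
    -- In the copy labelled r, `coeffMap` reads the coordinate r.1. Starting from the basis vector q
    -- in a copy with r.1 = p therefore yields the (p, q) coefficient.
    refine ⟨EuclideanSpace.single (q, (p, Classical.arbitrary ι)) 1, ?_⟩
    ext g
    rw [coeffMap_apply, Finset.sum_eq_single (p, Classical.arbitrary ι)]
    · simp [prodRep_apply, Prod.ext_iff]
    · intro r _ hr
      rw [prodRep_apply]
      refine Finset.sum_eq_zero fun q' _ => ?_
      rw [PiLp.single_apply, if_neg fun h => hr (congrArg Prod.snd h), mul_zero]
    · simp
  exact h1 hφ

end Simulation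

/-! ### Algorithms from matrix coefficients -/

section Achievability

variable {G V : Type*} [Group G] [NormedAddCommGroup V] [InnerProductSpace ℂ V]
  [FiniteDimensional ℂ V] [Nontrivial V] (π : G →* (V ≃ₗᵢ[ℂ] V)) {t : ℕ}

theorem exists_ne_zero_mem_coeffSpace (t : ℕ) :
    ∃ φ ∈ coeffSpace (tensorPowerRep π t), φ 1 ≠ 0 := by
  let b := stdOrthonormalBasis ℂ V
  have : Nonempty (Fin (Module.finrank ℂ V)) := ⟨⟨0, Module.finrank_pos⟩⟩
  let p : Fin t → Fin (Module.finrank ℂ V) := fun _ => Classical.arbitrary _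
  refine ⟨prodCoeff b π p p, ?_, ?_⟩
  · rw [coeffSpace_tensorPowerRep b]
    exact Submodule.subset_span ⟨(p, p), rfl⟩
  · simp [prodCoeff, queryCoeff_one]

variable [Fintype G]

/-- The translates of a matrix coefficient of `π^{⊗t}` are, up to a Gram-preserving change, the
states of a `t`-query circuit. -/
theorem exists_isReachable_gram {φ : G → ℂ} (hφ : φ ∈ coeffSpace (tensorPowerRep π t)) :
    ∃ (N : ℕ) (χ : G → Register V N), IsReachable π N t χ ∧ ∀ a a', inner ℂ (χ a) (χ a') =
      inner ℂ (rightRegular G a (WithLp.toLp 2 φ)) (rightRegular G a' (WithLp.toLp 2 φ)) := by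
  let ι := Fin (Module.finrank ℂ V)
  let b : OrthonormalBasis ι ℂ V := stdOrthonormalBasis ℂ V
  have : Nonempty ι := ⟨⟨0, Module.finrank_pos⟩⟩
  rw [coeffSpace_tensorPowerRep b] at hφ
  obtain ⟨ψ, hψ⟩ := exists_inner_eq_of_mem_range (inner_prodRep b π t)
    inner_rightRegular (coeffMap_prodRep b π t) (mem_range_coeffMap b π hφ)
  -- The total dimension is n^t · n^t · n with n = dim V. The extra factor n in the multiplicity
  -- space makes it divisible by dim V even for t = 0.
  let N := Fintype.card ((Fin t → ι) × (Fin t → ι))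
  have hN : ∀ s : Fin t, Fintype.card (({j // j ≠ s} → ι) × ((Fin t → ι) × ι)) = N := fun s => by
    have h1 : Fintype.card (Fin t → ι) = Fintype.card ι * Fintype.card ({j // j ≠ s} → ι) := by
      rw [Fintype.card_congr (Equiv.funSplitAt s ι), Fintype.card_prod]
    simp only [N, Fintype.card_prod]
    rw [mul_comm (Fintype.card (Fin t → ι)) (Fintype.card ι), ← mul_assoc,
      mul_comm _ (Fintype.card ι), ← h1]
  have ε : (Fin t → ι) × ((Fin t → ι) × ι) ≃ ι × Fin N :=
    Fintype.equivOfCardEq (by simp only [N, Fintype.card_prod, Fintype.card_fin]; ring)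
  let σ := registerIso b ε
  refine ⟨N, fun a => σ (prodRep b π t _ a ψ), ?_, fun a a' => ?_⟩
  · simp only [prodRep_eq_slotOp]
    exact slotOp_partialCoeff_isReachable b π hN ψ t le_rfl σ
  · exact (σ.inner_map_map _ _).trans (hψ a a')

/-- The algorithm mimics preparing R(a)φ in L²(G), measuring in the standard basis and answering
p(k) on outcome k, which has probability |φ(ka)|². -/
theorem exists_algorithm {X : Type*} [Fintype X] [DecidableEq X] (f : G → X) {φ : G → ℂ}
    (hφ : φ ∈ coeffSpace (tensorPowerRep π t)) (h1 : ∑ g, ‖φ g‖ ^ 2 = 1) (p : G → X) :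
    ∃ A : QueryAlgorithm V X t, A.successProb π f =
      (1 / (Fintype.card G : ℝ)) * ∑ a, ∑ k with p k = f a, ‖φ (k * a)‖ ^ 2 := by
  obtain ⟨N, χ, ⟨ψ, U, hU⟩, hχ⟩ := exists_isReachable_gram π hφ
  obtain ⟨W, hWχ, hW⟩ := exists_contraction_of_gram (Z := Register V N)
    (E := EuclideanSpace ℂ G) (u := χ) (w := fun a => rightRegular G a (WithLp.toLp 2 φ)) hχ
  obtain ⟨P, hP, hP1, hPW⟩ := exists_povm_of_contraction W hW p (f 1)
  have hnφ : ‖rightRegular G 1 (WithLp.toLp 2 φ)‖ = 1 := by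
    rw [map_one, Module.End.one_apply, EuclideanSpace.norm_eq]
    simp [h1]
  have hWn : ∀ a, ‖W (χ a)‖ = ‖χ a‖ := fun a => by
    have h2 : (‖χ a‖ : ℂ) ^ 2 = (‖W (χ a)‖ : ℂ) ^ 2 := by
      rw [hWχ]
      exact (inner_self_eq_norm_sq_to_K (𝕜 := ℂ) (χ a)).symm.trans
        ((hχ a a).trans (inner_self_eq_norm_sq_to_K _))
    have h3 : ‖χ a‖ ^ 2 = ‖W (χ a)‖ ^ 2 := by exact_mod_cast h2
    exact ((sq_eq_sq₀ (norm_nonneg _) (norm_nonneg _)).1 h3).symm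
  let A : QueryAlgorithm V X t :=
    { N := N
      input := ψ
      norm_input := by rw [← norm_foldl π ψ U 1, ← hU, ← hWn, hWχ, hnφ]
      U := U
      E := P
      E_pos := hP
      E_sum := hP1 }
  refine ⟨A, ?_⟩
  rw [QueryAlgorithm.successProb]
  congr 1
  refine Finset.sum_congr rfl fun a _ => ?_
  have hout : A.output π a = χ a := (hU a).symm
  rw [QueryAlgorithm.outcomeProb, hout]
  refine (hPW (f a) (χ a) (hWn a)).trans (Finset.sum_congr rfl fun k _ => ?_)
  rw [hWχ, rightRegular_apply]

end Achievability

/-! ### Optimality and the reduction from cosets to the subgroup -/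

section Main

theorem IsCosetIdentification.apply_eq {G X : Type*} [Group G] [MulAction G X] {f : G → X}
    (hf : IsCosetIdentification f) (g : G) : f g = g • f 1 := by
  rw [← hf.equivariant, mul_one]

variable {G V X : Type*} [Group G] [Fintype G] [NormedAddCommGroup V] [InnerProductSpace ℂ V]
  (π : G →* (V ≃ₗᵢ[ℂ] V)) [MulAction G X] {f : G → X}

theorem sum_filter_coset (H : Subgroup G) [Fintype H] [DecidablePred (· ∈ H)] (F : G → ℝ) :
    ∑ g with g ∈ H, F g = ∑ h : H, F h :=
  Finset.sum_subtype _ (by simp) F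

/-- If f(c) = x₀ and f(k) = x, the fibre over x is kc⁻¹Hc. Translating φ on both sides moves it to H
without leaving the coefficient space. -/
theorem sum_fibre_le [DecidableEq X] (hf : IsCosetIdentification f) (x₀ : X) {H : Subgroup G}
    [Fintype H] (hH : H = MulAction.stabilizer G x₀) {t : ℕ} (x : X) {φ : G → ℂ}
    (hφ : φ ∈ coeffSpace (tensorPowerRep π t)) :
    ∑ a with f a = x, ‖φ a‖ ^ 2 ≤ maxSharedFraction π H t * ∑ a, ‖φ a‖ ^ 2 := by
  classical
  obtain ⟨c, hc⟩ := hf.surjective x₀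
  obtain ⟨k, hk⟩ := hf.surjective x
  have hM := isBiInvariant_coeffSpace (tensorPowerRep π t)
  have h1 := sum_subgroup_le_maxSharedFraction (H := H) π
    (hM.right _ (hM.left φ hφ (k * c⁻¹)) c)
  have h2 : ∀ m : G, f (k * c⁻¹ * (m * c)) = x ↔ m ∈ H := fun m => by
    rw [hH, MulAction.mem_stabilizer_iff, hf.equivariant, hf.equivariant, hc, ← hk,
      hf.apply_eq k, mul_smul, smul_left_cancel_iff, inv_smul_eq_iff, ← hf.apply_eq c, hc]
  have h3 : ∑ a with f a = x, ‖φ a‖ ^ 2 = ∑ h : H, ‖φ (k * c⁻¹ * (h * c))‖ ^ 2 := by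
    rw [← sum_filter_coset H (fun g => ‖φ (k * c⁻¹ * (g * c))‖ ^ 2), Finset.sum_filter,
      Finset.sum_filter, ← Equiv.sum_comp ((Equiv.mulRight c).trans (Equiv.mulLeft (k * c⁻¹)))]
    simp only [Equiv.trans_apply, Equiv.coe_mulRight, Equiv.coe_mulLeft, h2]
  have h4 : ∑ a, ‖φ (k * c⁻¹ * (a * c))‖ ^ 2 = ∑ a, ‖φ a‖ ^ 2 :=
    Equiv.sum_comp ((Equiv.mulRight c).trans (Equiv.mulLeft (k * c⁻¹))) fun a => ‖φ a‖ ^ 2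
  rw [h3, ← h4]
  exact h1

theorem isGreatest_successProbs [FiniteDimensional ℂ V] [Nontrivial V] [Fintype X]
    (hf : IsCosetIdentification f) (x₀ : X) {H : Subgroup G}
    (hH : H = MulAction.stabilizer G x₀) (t : ℕ) :
    IsGreatest (successProbs π f t) (maxSharedFraction π H t) := by
  classical
  constructor
  · obtain ⟨φ₀, hφ₀, hne⟩ := exists_ne_zero_mem_coeffSpace π t
    obtain ⟨φ, hφ, hφ1, hφH⟩ :=
      exists_sum_subgroup_eq_maxSharedFraction (H := H) π (maxSharedFraction_pos π hφ₀ hne)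
    obtain ⟨c, hc⟩ := hf.surjective x₀
    have hM := isBiInvariant_coeffSpace (tensorPowerRep π t)
    -- The extremal φ is shifted by c⁻¹ on the right because f(1) need not be x₀. The answer f(k⁻¹c)
    -- is correct exactly when kac⁻¹ lies in H, so every a succeeds with the same probability, the
    -- mass of φ on H.
    obtain ⟨A, hA⟩ := exists_algorithm π f (hM.right φ hφ c⁻¹)
      ((Equiv.sum_comp (Equiv.mulRight c⁻¹) fun g => ‖φ g‖ ^ 2).trans hφ1) (fun k => f (k⁻¹ * c))
    refine ⟨A, ?_⟩
    have h1 : ∀ a, ∑ k with f (k⁻¹ * c) = f a, ‖φ (k * a * c⁻¹)‖ ^ 2 =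
        maxSharedFraction π H t := fun a => by
      have h2 : ∀ m : G, f ((m * c * a⁻¹)⁻¹ * c) = f a ↔ m ∈ H := fun m => by
        rw [hH, MulAction.mem_stabilizer_iff, hf.equivariant, hc, hf.apply_eq a, inv_smul_eq_iff,
          smul_smul, inv_mul_cancel_right, mul_smul, ← hf.apply_eq c, hc, eq_comm]
      rw [← hφH, ← sum_filter_coset H (fun g => ‖φ g‖ ^ 2), Finset.sum_filter, Finset.sum_filter,
        ← Equiv.sum_comp ((Equiv.mulRight c).trans (Equiv.mulRight a⁻¹))]
      simp only [Equiv.trans_apply, Equiv.coe_mulRight, h2]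
      simp
    change A.successProb π f = _
    rw [hA]
    simp only [h1, Finset.sum_const, Finset.card_univ, nsmul_eq_mul]
    field_simp
  · rintro _ ⟨A, rfl⟩
    exact A.successProb_le π f fun x φ hφ => sum_fibre_le π hf x₀ hH x hφ

end Main

end QuantumQuery

open QuantumQuery
theorem corollary5 {G : Type*} [Group G] [Fintype G]
    {V : Type*} [NormedAddCommGroup V] [InnerProductSpace ℂ V] [FiniteDimensional ℂ V]
    [Nontrivial V] (π : G →* (V ≃ₗᵢ[ℂ] V))
    {X : Type*} [Fintype X] [MulAction G X] (f : G → X) (hf : IsCosetIdentification f)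
    (x₀ : X) (H : Subgroup G) (hH : H = MulAction.stabilizer G x₀) :
    (∀ t : ℕ, IsGreatest (sharedFractions π H t) (maxSharedFraction π H t) ∧
      IsGreatest (successProbs π f t) (maxSharedFraction π H t)) ∧
    exactQueryComplexity π f = leastOrTop {t | ExistsCoveredIrrep π H t} ∧
    boundedErrorQueryComplexity π f = leastOrTop {t | 2 / 3 ≤ maxSharedFraction π H t} := by
  classical
  have hG := isGreatest_successProbs π hf x₀ hH
  refine ⟨fun t => ⟨isGreatest_maxSharedFraction H π t, hG t⟩, ?_, ?_⟩
  · refine congrArg leastOrTop (Set.ext fun t => ?_)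
    obtain ⟨e, he⟩ := (isBiInvariant_coeffSpace (tensorPowerRep π t)).exists_isProjectionKernel
    rw [Set.mem_ofPred_eq, Set.mem_ofPred_eq, existsCoveredIrrep_iff π he]
    constructor
    · rintro ⟨A, hA⟩
      exact le_antisymm (maxSharedFraction_le_one H π t) (hA ▸ (hG t).2 ⟨A, rfl⟩)
    · intro h
      obtain ⟨A, hA⟩ := (hG t).1
      exact ⟨A, hA.trans h⟩
  · refine congrArg leastOrTop (Set.ext fun t => ?_)
    constructor
    · rintro ⟨A, hA⟩
      exact hA.trans ((hG t).2 ⟨A, rfl⟩)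
    · intro h
      obtain ⟨A, hA⟩ := (hG t).1
      exact ⟨A, h.trans_eq hA.symm⟩
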